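/- Fix a prime number $p$. For a scheme $S$, a (commutative, one-parameter) formal Lie group over $S$ is an fppf sheaf $X$ of commutative groups on the category of $S$-schemes which, as a sheaf pointed by its zero section, is Zariski locally on $S$ isomorphic to $\operatorname{Spf}\mathcal{O}_S[[T]]$ pointed by $T=0$. For $h\ge 0$, let $I_X$ be the ideal of functions on $X$ that vanish along the zero section; $X$ has height $\ge h$ if the endomorphism $[p]^*$ induced by multiplication by $p$ on $X$ maps $I_X$ into $I_X^{p^h}$ (locally, in a coordinate $T$ in which $X$ is given by a formal group law $F$: $[p]_F(T)$ is divisible by $T^{p^h}$). $X$ has (exact) height $h$ if it has height $\ge h$ and no base change of $X$ to a nonempty $S$-scheme has height $\ge h+1$. Let $\mathrm{FLG}^h(S)$ be the groupoid of formal Lie groups of height $h$ over $S$ and their isomorphisms. Theorem. Let $\mathcal{O}$ be a valuation ring and $K$ its field of fractions. Then for every $h\ge 1$ the base change functor \[ \mathrm{FLG}^h(\mathcal{O})\longrightarrow \mathrm{FLG}^h(K) \] (where $\mathrm{FLG}^h(A)$ means $\mathrm{FLG}^h(\operatorname{Spec} A)$) is fully faithful. That is, for all formal Lie groups $X,Y$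 of height $h$ over $\mathcal{O}$, base change gives a bijection $\operatorname{Isom}_{\mathcal{O}}(X,Y)\to\operatorname{Isom}_K(X_K,Y_K)$. -/

import Mathlib

open CategoryTheory AlgebraicGeometry Opposite

universe u

noncomputable section

namespace FormalLie

/-- fppf sheaves of commutative groups on the category of all schemes over `S`. -/
abbrev GroupSheaf (S : Scheme.{u}) : Type (u + 1) :=
  Sheaf (Scheme.fppfTopology.{u}.over S) AddCommGrpCat.{u}

/-- Base change of fppf sheaves along `f : T ⟶ S`: the restriction of a sheaf on `S`-schemes to
`T`-schemes, so that `(X_T)(Z ⟶ T) = X(Z ⟶ T ⟶ S)`. -/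
abbrev restrict {T S : Scheme.{u}} (f : T ⟶ S) : GroupSheaf S ⥤ GroupSheaf T :=
  Scheme.fppfTopology.overMapPullback AddCommGrpCat.{u} f

/-- A section `a ∈ Γ(T, 𝒪_T)` is locally nilpotent if every point of `T` has an open
neighbourhood on which `a` is nilpotent. -/
def IsLocallyNilpotent (T : Scheme.{u}) (a : Γ(T, ⊤)) : Prop :=
  ∀ t : T, ∃ (U : T.Opens), t ∈ U ∧ IsNilpotent (a |_ U)

/-- An isomorphism of pointed sheaves `X ≅ Spf 𝒪_S[[T]]`, where the formal line
`Spf 𝒪_S[[T]] = colim_n Spec 𝒪_S[T]/(T ^ (n + 1))` is described through its points: its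
`Z`-points are the locally nilpotent sections of `𝒪_Z`, and it is pointed by `0`. -/
structure Coordinate {S : Scheme.{u}} (X : GroupSheaf S) where
  equiv (Z : Over S) : X.obj.obj (op Z) ≃ {a : Γ(Z.left, ⊤) // IsLocallyNilpotent Z.left a}
  equiv_map {Z Z' : Over S} (g : Z' ⟶ Z) (x : X.obj.obj (op Z)) :
    (equiv Z' (X.obj.map g.op x)).1 = g.left.appTop (equiv Z x).1
  equiv_zero (Z : Over S) : (equiv Z 0).1 = 0

/-- Commutative, one-parameter formal Lie groups over `S`: fppf sheaves of commutative groups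
which, pointed by their zero section, are isomorphic to `Spf 𝒪_S[[T]]` Zariski locally on `S`. -/
def IsFormalLieGroup (S : Scheme.{u}) : ObjectProperty (GroupSheaf S) := fun X =>
  ∀ s : S, ∃ U : S.Opens, s ∈ U ∧ Nonempty (Coordinate ((restrict U.ι).obj X))

/-- The ring of functions on `X`: the natural transformations from `X` to the structure
sheaf `Z ↦ Γ(Z, 𝒪_Z)`, with pointwise operations. -/
def functions {S : Scheme.{u}} (X : GroupSheaf S) :
    Subring ((Z : Over S) → X.obj.obj (op Z) → Γ(Z.left, ⊤)) where
  carrier := {φ | ∀ ⦃Z Z' : Over S⦄ (g : Z' ⟶ Z) (x : X.obj.obj (op Z)),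
    φ Z' (X.obj.map g.op x) = g.left.appTop (φ Z x)}
  mul_mem' ha hb _ _ g x := by simp [ha g x, hb g x]
  one_mem' _ _ g x := by simp
  add_mem' ha hb _ _ g x := by simp [ha g x, hb g x]
  zero_mem' _ _ g x := by simp
  neg_mem' ha _ _ g x := by simp [ha g x]

/-- The ideal `I_X` of functions on `X` that vanish along the zero section. -/
def augmentationIdeal {S : Scheme.{u}} (X : GroupSheaf S) : Ideal (functions X) where
  carrier := {φ | ∀ Z : Over S, φ.1 Z 0 = 0}
  add_mem' ha hb Z := by simp [ha Z, hb Z]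
  zero_mem' Z := by simp
  smul_mem' c φ h Z := by simp [h Z]

/-- The endomorphism `[m]^*` of the ring of functions on `X` induced by multiplication by `m`
on the commutative group `X`. -/
def mulPullback {S : Scheme.{u}} (m : ℕ) (X : GroupSheaf S) : functions X →+* functions X where
  toFun φ := ⟨fun Z x => φ.1 Z (m • x), fun Z Z' g x => by
    rw [← φ.2 g (m • x), map_nsmul]⟩
  map_one' := rfl
  map_mul' _ _ := rfl
  map_zero' := rfl
  map_add' _ _ := rfl

/-- `X` has height `≥ h` (with respect to `p`): `[p]^*` maps `I_X` into `I_X ^ (p ^ h)`, over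
every affine scheme `T` over `S`. -/
def HeightGE (p h : ℕ) (S : Scheme.{u}) : ObjectProperty (GroupSheaf S) := fun X =>
  ∀ (T : Scheme.{u}) [IsAffine T] (f : T ⟶ S),
    ∀ φ ∈ augmentationIdeal ((restrict f).obj X),
      mulPullback p ((restrict f).obj X) φ ∈ augmentationIdeal ((restrict f).obj X) ^ (p ^ h)

/-- `X` has (exact) height `h`: it lies in the open complement of the height `≥ h + 1` locus in
the height `≥ h` locus, i.e. it has height `≥ h` and no base change of `X` to a nonempty scheme
has height `≥ h + 1`. -/
def HasHeight (p h : ℕ) (S : Scheme.{u}) : ObjectProperty (GroupSheaf S) := fun X =>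
  HeightGE p h S X ∧
    ∀ (T : Scheme.{u}) [Nonempty T] (f : T ⟶ S), ¬ HeightGE p (h + 1) T ((restrict f).obj X)

/-- The property of being a formal Lie group of height `h`. -/
def IsFormalLieGroupOfHeight (p h : ℕ) (S : Scheme.{u}) : ObjectProperty (GroupSheaf S) :=
  fun X => IsFormalLieGroup S X ∧ HasHeight p h S X

/-- The groupoid of formal Lie groups of height `h` over `S` and their isomorphisms. -/
abbrev FLG (p h : ℕ) (S : Scheme.{u}) : Type (u + 1) :=
  Core (IsFormalLieGroupOfHeight p h S).FullSubcategory

lemma IsLocallyNilpotent.map {T T' : Scheme.{u}} (f : T' ⟶ T) {a : Γ(T, ⊤)}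
    (ha : IsLocallyNilpotent T a) : IsLocallyNilpotent T' (f.appTop a) := by
  intro t
  obtain ⟨U, hU, n, hn⟩ := ha (f t)
  refine ⟨f ⁻¹ᵁ U, hU, n, ?_⟩
  have key : (f.appTop a) |_ (f ⁻¹ᵁ U) = f.app U (a |_ U) := by
    have := f.naturality (homOfLE (le_top : U ≤ ⊤)).op
    exact (ConcreteCategory.congr_hom this a).symm
  rw [key, ← map_pow, hn, map_zero]

/-- Transport of a coordinate along an isomorphism. -/
def Coordinate.ofIso {S : Scheme.{u}} {X Y : GroupSheaf S} (e : X ≅ Y) (c : Coordinate X) :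
    Coordinate Y where
  equiv Z := (((sheafSections _ _).obj (op Z)).mapIso e).symm.addCommGroupIsoToAddEquiv.toEquiv.trans
    (c.equiv Z)
  equiv_map {Z Z'} g y := by
    have := ConcreteCategory.congr_hom (e.inv.hom.naturality g.op) y
    exact (congrArg (fun x => (c.equiv Z' x).1) this).trans (c.equiv_map g _)
  equiv_zero Z := by
    refine (congrArg (fun x => (c.equiv Z x).1) ?_).trans (c.equiv_zero Z)
    exact map_zero (e.inv.hom.app (op Z)).hom

/-- Base change of a coordinate. -/
def Coordinate.restrict {T S : Scheme.{u}} {X : GroupSheaf S} (c : Coordinate X) (f : T ⟶ S) :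
    Coordinate ((restrict f).obj X) where
  equiv Z := c.equiv ((Over.map f).obj Z)
  equiv_map g x := c.equiv_map ((Over.map f).map g) x
  equiv_zero Z := c.equiv_zero ((Over.map f).obj Z)

/-- Transitivity of base change. -/
def restrictCompIso {T T' S : Scheme.{u}} (g : T' ⟶ T) (f : T ⟶ S) (X : GroupSheaf S) :
    (restrict g).obj ((restrict f).obj X) ≅ (restrict (g ≫ f)).obj X :=
  (Scheme.fppfTopology.overMapPullbackComp AddCommGrpCat.{u} g f).app X

lemma IsFormalLieGroup.restrict {T S : Scheme.{u}} (f : T ⟶ S) {X : GroupSheaf S}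
    (hX : IsFormalLieGroup S X) : IsFormalLieGroup T ((restrict f).obj X) := by
  intro t
  obtain ⟨U, hU, ⟨c⟩⟩ := hX (f t)
  refine ⟨f ⁻¹ᵁ U, hU, ⟨?_⟩⟩
  have h : (f ∣_ U) ≫ U.ι = (f ⁻¹ᵁ U).ι ≫ f := morphismRestrict_ι f U
  have c' := (c.restrict (f ∣_ U)).ofIso (restrictCompIso (f ∣_ U) U.ι X)
  rw [h] at c'
  exact c'.ofIso (restrictCompIso (f ⁻¹ᵁ U).ι f X).symm

/-- Pullback of functions along a homomorphism of sheaves of groups. -/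
def functionsMap {S : Scheme.{u}} {X Y : GroupSheaf S} (e : X ⟶ Y) :
    functions Y →+* functions X where
  toFun φ := ⟨fun Z x => φ.1 Z (e.hom.app (op Z) x), fun Z Z' g x => by
    rw [← φ.2 g]
    exact congrArg (φ.1 Z') (ConcreteCategory.congr_hom (e.hom.naturality g.op) x)⟩
  map_one' := rfl
  map_mul' _ _ := rfl
  map_zero' := rfl
  map_add' _ _ := rfl

lemma functionsMap_mem {S : Scheme.{u}} {X Y : GroupSheaf S} (e : X ⟶ Y) (φ : functions Y)
    (hφ : φ ∈ augmentationIdeal Y) : functionsMap e φ ∈ augmentationIdeal X := by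
  intro Z
  exact (congrArg (φ.1 Z) (map_zero (e.hom.app (op Z)).hom)).trans (hφ Z)

lemma mulPullback_mem_of_iso {S : Scheme.{u}} {X Y : GroupSheaf S} (e : X ≅ Y) (m n : ℕ)
    (hX : ∀ φ ∈ augmentationIdeal X, mulPullback m X φ ∈ augmentationIdeal X ^ n) :
    ∀ φ ∈ augmentationIdeal Y, mulPullback m Y φ ∈ augmentationIdeal Y ^ n := by
  intro φ hφ
  have h1 := Ideal.mem_map_of_mem (functionsMap e.inv) (hX _ (functionsMap_mem e.hom φ hφ))
  rw [Ideal.map_pow] at h1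
  have h2 : (augmentationIdeal X).map (functionsMap e.inv) ≤ augmentationIdeal Y :=
    Ideal.map_le_iff_le_comap.2 fun ψ hψ => functionsMap_mem e.inv ψ hψ
  have h3 := Ideal.pow_right_mono h2 n h1
  convert h3 using 1
  apply Subtype.ext
  funext Z y
  refine congrArg (φ.1 Z) ?_
  rw [map_nsmul]
  congr 1
  have := congrArg (fun q => q.hom.app (op Z)) e.inv_hom_id
  exact (ConcreteCategory.congr_hom this y).symm

lemma HeightGE.ofIso {p h : ℕ} {S : Scheme.{u}} {X Y : GroupSheaf S} (e : X ≅ Y)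
    (hX : HeightGE p h S X) : HeightGE p h S Y := fun T _ f =>
  mulPullback_mem_of_iso ((restrict f).mapIso e) p (p ^ h) (hX T f)

lemma HeightGE.restrict {p h : ℕ} {T S : Scheme.{u}} (f : T ⟶ S) {X : GroupSheaf S}
    (hX : HeightGE p h S X) : HeightGE p h T ((restrict f).obj X) := fun T' _ g =>
  mulPullback_mem_of_iso (restrictCompIso g f X).symm p (p ^ h) (hX T' (g ≫ f))

lemma HasHeight.restrict {p h : ℕ} {T S : Scheme.{u}} (f : T ⟶ S) {X : GroupSheaf S}
    (hX : HasHeight p h S X) : HasHeight p h T ((restrict f).obj X) :=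
  ⟨hX.1.restrict f, fun T' _ g hg => hX.2 T' (g ≫ f) (hg.ofIso (restrictCompIso g f X))⟩

/-- The base change functor `FLG^h(S) ⥤ FLG^h(T)` along `f : T ⟶ S`. -/
def FLG.baseChange (p h : ℕ) {T S : Scheme.{u}} (f : T ⟶ S) : FLG p h S ⥤ FLG p h T :=
  (ObjectProperty.lift _ (ObjectProperty.ι _ ⋙ restrict f)
    fun X => ⟨X.property.1.restrict f, X.property.2.restrict f⟩).core

end FormalLie

end

noncomputable section

namespace FormalLie

/-! Over a local ring a formal Lie group has a global coordinate, so a homomorphism is a power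
series `f` without constant term, and over `K` the question is whether its coefficients are
integral. Put `q = p ^ h`, and let `a` and `b` be the series of multiplication by `p` on `X` and
`Y`, so that `f(a(T)) = b(f(T))`.

As `h ≥ 1`, the tangent action of `p` vanishes, so `p = 0` in the base. A derivative argument
(`coeffs_mulPullback_step`) then shows that `b` is a series in `T ^ q`. Exactness of the height at
the closed point makes its coefficient at `q` a unit (`HasHeight.isUnit_coeffs`), and `a` is
divisible by `T ^ q`. By Frobenius, `f ^ q` is a series in `T ^ q` with coefficients `f_i ^ q`.
Comparing coefficients of `T ^ (n * q)` therefore gives `b_q * f_n ^ q - α * f_n + r = 0`, with `α`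
and `r` integral by induction on `n`. Thus `f_n` is integral over `O`, hence lies in `O`
(`coeff_mem_range_of_comp_eq`). The resulting series over `O` is additive because this can be
checked over `K` (`exists_hom_of_coeffs_mem_range`).

Functions on `X` become power series by evaluation at the universal points over `A[t] / (t ^ n)`.
The affine base is a scheme `S` with an isomorphism `π` to `Spec A`, so that spectra and arbitrary
affine schemes are treated alike. -/

open Polynomial in
/-- Sums of monomials have the evident coefficients. -/
lemma coeff_sum_range {A : Type*} [CommRing A] (a : ℕ → A) (N i : ℕ) :
    (∑ j ∈ Finset.range N, C (a j) * X ^ j : A[X]).coeff i = if i < N then a i else 0 := by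
  simp [Polynomial.finsetSum_coeff, Polynomial.coeff_C_mul, Polynomial.coeff_X_pow]

/-! ### Truncated polynomial rings. -/

/-- The truncated polynomial ring `A[t] / (t ^ n)`. -/
abbrev Trunc (n : ℕ) (A : Type u) [CommRing A] : Type u :=
  Polynomial A ⧸ Ideal.span {(Polynomial.X : Polynomial A) ^ n}

namespace Trunc

variable {A B : Type u} [CommRing A] [CommRing B]

/-- The structure map of the truncated polynomial ring. -/
def C (n : ℕ) (A : Type u) [CommRing A] : A →+* Trunc n A :=
  (Ideal.Quotient.mk _).comp Polynomial.C

/-- The variable of the truncated polynomial ring. -/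
def t (n : ℕ) (A : Type u) [CommRing A] : Trunc n A := Ideal.Quotient.mk _ Polynomial.X

lemma t_pow (n : ℕ) : t n A ^ n = 0 := by
  rw [t, ← map_pow, Ideal.Quotient.eq_zero_iff_mem]
  exact Ideal.mem_span_singleton_self _

lemma isNilpotent_t (n : ℕ) : IsNilpotent (t n A) := ⟨n, t_pow n⟩

/-- The universal property of the truncated polynomial ring. -/
def lift {n : ℕ} (g : A →+* B) (b : B) (hb : b ^ n = 0) : Trunc n A →+* B :=
  Ideal.Quotient.lift _ (Polynomial.eval₂RingHom g b) fun x hx => by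
    obtain ⟨y, rfl⟩ := Ideal.mem_span_singleton.1 hx
    simp [Polynomial.eval₂_mul, hb]

@[simp] lemma lift_C {n : ℕ} (g : A →+* B) (b : B) (hb : b ^ n = 0) (a : A) :
    lift g b hb (C n A a) = g a := by
  simp [lift, C]

@[simp] lemma lift_t {n : ℕ} (g : A →+* B) (b : B) (hb : b ^ n = 0) :
    lift g b hb (t n A) = b := by
  simp [lift, t]

lemma lift_comp_C {n : ℕ} (g : A →+* B) (b : B) (hb : b ^ n = 0) :
    (lift g b hb).comp (C n A) = g := RingHom.ext fun a => lift_C g b hb a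

lemma mk_eq_eval₂ {n : ℕ} (P : Polynomial A) :
    (Ideal.Quotient.mk _ P : Trunc n A) = P.eval₂ (C n A) (t n A) := by
  induction P using Polynomial.induction_on' with
  | add P Q hP hQ => simp [hP, hQ, Polynomial.eval₂_add]
  | monomial i a =>
    rw [Polynomial.eval₂_monomial, ← Polynomial.C_mul_X_pow_eq_monomial, map_mul, map_pow]
    rfl

lemma coeff_eq_of_eval₂_eq {n : ℕ} {P Q : Polynomial A}
    (h : P.eval₂ (C n A) (t n A) = Q.eval₂ (C n A) (t n A)) {i : ℕ} (hi : i < n) :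
    P.coeff i = Q.coeff i := by
  rw [← mk_eq_eval₂, ← mk_eq_eval₂, Ideal.Quotient.eq, Ideal.mem_span_singleton,
    Polynomial.X_pow_dvd_iff] at h
  simpa [sub_eq_zero] using h i hi

/-- The coefficients of an element of the truncated polynomial ring. -/
def coeff {n : ℕ} (i : ℕ) (x : Trunc n A) : A := (Quotient.out x : Polynomial A).coeff i

lemma eval₂_out {n : ℕ} (x : Trunc n A) :
    (Quotient.out x : Polynomial A).eval₂ (C n A) (t n A) = x := by
  rw [← mk_eq_eval₂]
  exact Quotient.out_eq x

lemma eval₂_sum {n : ℕ} (a : ℕ → A) (N : ℕ) :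
    (∑ i ∈ Finset.range N, Polynomial.C (a i) * Polynomial.X ^ i).eval₂ (C n A) (t n A) =
      ∑ i ∈ Finset.range N, C n A (a i) * t n A ^ i := by
  simp [Polynomial.eval₂_finsetSum]

lemma coeff_sum {n : ℕ} (a : ℕ → A) {i : ℕ} (hi : i < n) :
    coeff i (∑ j ∈ Finset.range n, C n A (a j) * t n A ^ j) = a i := by
  have := coeff_eq_of_eval₂_eq (n := n)
    ((eval₂_out _).trans (eval₂_sum a n).symm) hi
  rw [coeff_sum_range, if_pos hi] at this
  exact this

lemma sum_coeff {n : ℕ} (x : Trunc n A) :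
    ∑ j ∈ Finset.range n, C n A (coeff j x) * t n A ^ j = x := by
  rw [← eval₂_sum]
  conv_rhs => rw [← eval₂_out x]
  rw [← mk_eq_eval₂, ← mk_eq_eval₂, Ideal.Quotient.eq, Ideal.mem_span_singleton,
    Polynomial.X_pow_dvd_iff]
  intro i hi
  rw [Polynomial.coeff_sub, coeff_sum_range, if_pos hi]
  exact sub_self _

/-- Two elements with the same coefficients agree. -/
lemma sum_injective {n : ℕ} {a b : ℕ → A}
    (h : ∑ j ∈ Finset.range n, C n A (a j) * t n A ^ j =
      ∑ j ∈ Finset.range n, C n A (b j) * t n A ^ j) {i : ℕ} (hi : i < n) : a i = b i := by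
  rw [← coeff_sum a hi, ← coeff_sum b hi, h]

/-- Functoriality of the truncated polynomial ring. -/
def map (n : ℕ) (g : A →+* B) : Trunc n A →+* Trunc n B :=
  lift ((C n B).comp g) (t n B) (t_pow n)

lemma map_t (n : ℕ) (g : A →+* B) : map n g (t n A) = t n B := lift_t _ _ _

lemma map_C (n : ℕ) (g : A →+* B) (a : A) : map n g (C n A a) = C n B (g a) := lift_C _ _ _ _

lemma map_injective (n : ℕ) {g : A →+* B} (hg : Function.Injective g) :
    Function.Injective (map n g) := by
  intro x y h
  rw [← sum_coeff x, ← sum_coeff y] at h ⊢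
  simp only [map_sum, map_mul, map_pow, map_C, map_t] at h
  refine Finset.sum_congr rfl fun i hi => ?_
  rw [hg (sum_injective h (Finset.mem_range.1 hi))]

end Trunc

/-! ### Integrality of the coefficients of a homomorphism. -/

section Integrality

open Polynomial

/-- Since `W` has no constant term and `m ≥ 2`, the coefficient of `W ^ m` at `n` involves only
coefficients of `W` below `n`. Truncating `W` there gives a liftable polynomial `V`. -/
lemma coeff_pow_mem_range {O K : Type*} [CommRing O] [CommRing K] (g : O →+* K)
    {W : K[X]} (h0 : W.coeff 0 = 0) {n : ℕ} (hW : ∀ i < n, W.coeff i ∈ Set.range g)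
    {m : ℕ} (hm : 2 ≤ m) : (W ^ m).coeff n ∈ Set.range g := by
  set V : K[X] := ∑ j ∈ Finset.range n, C (W.coeff j) * X ^ j with hV
  have hVl : V ∈ lifts g := by
    rw [lifts_iff_coeff_lifts]
    intro i
    rw [hV, coeff_sum_range]
    split_ifs with hi
    · exact hW i hi
    · exact ⟨0, map_zero g⟩
  have hd : X ^ n ∣ W - V := by
    rw [X_pow_dvd_iff]
    intro i hi
    rw [coeff_sub, hV, coeff_sum_range, if_pos hi, sub_self]
  have hWX : X ∣ W := X_dvd_iff.2 h0
  have hVX : X ∣ V := by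
    rw [X_dvd_iff, hV, coeff_sum_range, h0, ite_self]
  -- The difference `W - V` contributes `X ^ n`; every term of the geometric sum contains a further
  -- factor `W` or `V`, hence `X`.
  have key : X ^ (n + 1) ∣ W ^ m - V ^ m := by
    rw [← Commute.mul_geom_sum₂ (Commute.all W V), pow_succ]
    refine mul_dvd_mul hd (Finset.dvd_sum fun i hi => ?_)
    rcases Nat.eq_zero_or_pos i with rfl | hi'
    · exact Dvd.dvd.mul_left (dvd_pow hVX (by omega)) _
    · exact Dvd.dvd.mul_right (dvd_pow hWX (by omega)) _
  have h1 := (X_pow_dvd_iff.1 key) n (Nat.lt_succ_self n)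
  rw [coeff_sub, sub_eq_zero] at h1
  rw [h1]
  exact (lifts_iff_coeff_lifts _).1 (Subsemiring.pow_mem _ hVl m) n

/-- The coefficients of a power series `f` over the fraction field of an integrally closed domain
are integral if `f (a (T)) = b (f (T))`, where `a` is divisible by `T ^ q` and `b` is an integral
power series in `T ^ q` with invertible leading term. -/
lemma coeff_mem_range_of_comp_eq {O K : Type*} [CommRing O] [IsDomain O] [IsIntegrallyClosed O]
    [Field K] [Algebra O K] [IsFractionRing O K] {p h : ℕ} [Fact p.Prime] [CharP K p]
    (hh : 1 ≤ h) {f : ℕ → K} {a b : ℕ → O} (f0 : f 0 = 0) (ha : ∀ i < p ^ h, a i = 0)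
    (hb : ∀ i, ¬ p ^ h ∣ i → b i = 0) (b0 : b 0 = 0) (hbq : IsUnit (b (p ^ h)))
    (H : ∀ N, ∀ i < N,
      (∑ j ∈ Finset.range N, C (f j) *
        (∑ l ∈ Finset.range N, C (algebraMap O K (a l)) * X ^ l) ^ j : K[X]).coeff i =
      (∑ j ∈ Finset.range N, C (algebraMap O K (b j)) *
        (∑ l ∈ Finset.range N, C (f l) * X ^ l) ^ j : K[X]).coeff i) (n : ℕ) :
    f n ∈ Set.range (algebraMap O K) := by
  have hp : 2 ≤ p := (Fact.out : p.Prime).two_le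
  set q := p ^ h with hq
  have hq2 : 2 ≤ q := hp.trans (Nat.le_self_pow (by omega) p)
  induction n using Nat.strong_induction_on with
  | _ n ih =>
  rcases Nat.eq_zero_or_pos n with rfl | hn
  · exact ⟨0, by rw [map_zero, f0]⟩
  -- The truncation just retains the coefficient at `n * q`, the one that isolates `f n`.
  set N := n * q + 1 with hN
  have hnN : n < N := by nlinarith
  have hqN : q < N := by nlinarith
  have key := H N (n * q) (by omega)
  set aP : K[X] := ∑ l ∈ Finset.range N, C (algebraMap O K (a l)) * X ^ l with haP
  set P : K[X] := ∑ l ∈ Finset.range N, C (f l) * X ^ l with hP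
  simp only [finsetSum_coeff, coeff_C_mul] at key
  have haPl : aP ∈ lifts (algebraMap O K) := by
    rw [lifts_iff_coeff_lifts]
    intro i
    rw [haP, coeff_sum_range]
    split_ifs
    · exact ⟨_, rfl⟩
    · exact ⟨0, map_zero _⟩
  have hcoe : ∀ j i, (aP ^ j).coeff i ∈ Set.range (algebraMap O K) := fun j i =>
    (lifts_iff_coeff_lifts _).1 (Subsemiring.pow_mem _ haPl j) i
  have haX : X ^ q ∣ aP := by
    rw [X_pow_dvd_iff]
    intro i hi
    rw [haP, coeff_sum_range, if_pos (by omega), ha i hi, map_zero]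
  rw [← Finset.add_sum_erase _ _ (Finset.mem_range.2 hnN)] at key
  -- Terms with `j < n` are integral by induction; those with `j > n` vanish because `aP ^ j` is
  -- divisible by `X ^ (q * j)`.
  have hL : ∑ j ∈ (Finset.range N).erase n, f j * (aP ^ j).coeff (n * q) ∈
      (algebraMap O K).range := by
    refine Subring.sum_mem _ fun j hj => ?_
    rcases lt_or_gt_of_ne (Finset.ne_of_mem_erase hj) with hlt | hgt
    · exact Subring.mul_mem _ (ih j hlt) (hcoe _ _)
    · have : (aP ^ j).coeff (n * q) = 0 := by
        have hdj := pow_dvd_pow_of_dvd haX j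
        rw [← pow_mul] at hdj
        exact X_pow_dvd_iff.1 hdj _ (by nlinarith)
      rw [this, mul_zero]
      exact Subring.zero_mem _
  set W : K[X] := P.map (iterateFrobenius K p h) with hWdef
  -- In characteristic `p`, raising to the power `q` raises both the coefficients and the variable
  -- to the power `q`.
  have hPq : P ^ q = expand K q W := by
    rw [hq, ← map_iterateFrobenius_expand, map_expand]
  have hW : ∀ i, W.coeff i = P.coeff i ^ q := by
    intro i
    rw [hWdef, coeff_map, hq]
    rfl
  have hPc : ∀ i ≤ n, P.coeff i = f i := fun i hi => by
    rw [hP, coeff_sum_range, if_pos (by omega)]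
  rw [← Finset.add_sum_erase _ _ (Finset.mem_range.2 hqN)] at key
  have hR : ∑ j ∈ (Finset.range N).erase q, algebraMap O K (b j) * (P ^ j).coeff (n * q) ∈
      (algebraMap O K).range := by
    refine Subring.sum_mem _ fun j hj => ?_
    by_cases hd : q ∣ j
    · obtain ⟨m, rfl⟩ := hd
      have hm1 : m ≠ 1 := by
        rintro rfl
        exact Finset.ne_of_mem_erase hj (mul_one q)
      rcases Nat.eq_zero_or_pos m with rfl | hm
      · rw [mul_zero, b0, map_zero, zero_mul]
        exact Subring.zero_mem _
      · refine Subring.mul_mem _ ⟨_, rfl⟩ ?_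
        rw [pow_mul, hPq, ← map_pow, coeff_expand_mul (by omega)]
        refine coeff_pow_mem_range _ ?_ (fun i hi => ?_) (by omega)
        · rw [hW, hPc 0 (by omega), f0, zero_pow (by omega)]
        · rw [hW, hPc i hi.le]
          exact Subring.pow_mem (algebraMap O K).range (ih i hi) q
    · rw [hb j hd, map_zero, zero_mul]
      exact Subring.zero_mem _
  rw [hPq, coeff_expand_mul (by omega), hW, hPc n le_rfl] at key
  obtain ⟨α, hα⟩ := hcoe n (n * q)
  obtain ⟨r, hr⟩ := hL
  obtain ⟨r', hr'⟩ := hR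
  obtain ⟨v, hv⟩ := hbq
  rw [← hr, ← hr', ← hα, ← hv] at key
  -- The relation, divided by the unit `v`, is a monic equation for `f n`; `q ≥ 2` keeps the linear
  -- part below the leading term.
  have hint : IsIntegral O (f n) := by
    refine ⟨X ^ q + (C (-(↑v⁻¹ * α) : O) * X + C (↑v⁻¹ * (r' - r) : O)), monic_X_pow_add ?_, ?_⟩
    · refine lt_of_le_of_lt degree_linear_le ?_
      exact_mod_cast hq2
    · have hvv : algebraMap O K (↑v⁻¹ : O) * algebraMap O K (v : O) = 1 := by
        rw [← map_mul, Units.inv_mul, map_one]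
      simp only [eval₂_add, eval₂_mul, eval₂_pow, eval₂_X, eval₂_C]
      simp only [map_neg, map_mul, map_sub]
      linear_combination (-algebraMap O K (↑v⁻¹ : O)) * key - f n ^ q * hvv
  exact IsIntegrallyClosed.isIntegral_iff.1 hint

end Integrality

/-! ### Locally nilpotent sections and gluing. -/

section LocalSections

open TopologicalSpace

lemma ι_appTop_eq_restrict {T : Scheme.{u}} (U : T.Opens) (a : Γ(T, ⊤)) :
    U.ι.appTop a = 
      T.presheaf.map (homOfLE U.ι_image_top.le).op (a |_ U) := by
  rw [Scheme.Opens.ι_appTop]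
  exact ConcreteCategory.congr_hom (T.presheaf.map_comp (homOfLE (le_top : U ≤ ⊤)).op
    (homOfLE U.ι_image_top.le).op) a

lemma isLocallyNilpotent_of_isNilpotent {T : Scheme.{u}} {a : Γ(T, ⊤)} (ha : IsNilpotent a) :
    IsLocallyNilpotent T a := fun _ =>
  ⟨⊤, trivial, ha.map (T.presheaf.map (homOfLE _).op).hom⟩

/-- On a quasi-compact scheme, nilpotence means an empty basic open. At a point of the basic open
the germ would be both nilpotent and a unit. -/
lemma IsLocallyNilpotent.isNilpotent {T : Scheme.{u}} [CompactSpace T] {a : Γ(T, ⊤)}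
    (ha : IsLocallyNilpotent T a) : IsNilpotent a := by
  rw [Scheme.isNilpotent_iff_basicOpen_eq_bot, eq_bot_iff]
  intro x hx
  obtain ⟨U, hxU, hU⟩ := ha x
  rw [Scheme.mem_basicOpen_top] at hx
  have h1 : T.presheaf.germ ⊤ x trivial a = T.presheaf.germ U x hxU (a |_ U) :=
    (TopCat.Presheaf.germ_res_apply T.presheaf (homOfLE le_top) x hxU a).symm
  have h2 : IsNilpotent (T.presheaf.germ ⊤ x trivial a) := by
    rw [h1]
    exact hU.map (T.presheaf.germ U x hxU).hom
  obtain ⟨n, hn⟩ := h2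
  exact absurd (hn ▸ hx.pow n) not_isUnit_zero

lemma eq_of_locally_eq {T : Scheme.{u}} {a b : Γ(T, ⊤)}
    (h : ∀ x : T, ∃ U : T.Opens, x ∈ U ∧ U.ι.appTop a = U.ι.appTop b) : a = b := by
  choose U hU hab using h
  refine T.sheaf.eq_of_locally_eq' (fun x => (U x).ι ''ᵁ ⊤) ⊤ (fun x => homOfLE le_top) ?_ a b ?_
  · intro x _
    rw [Opens.mem_iSup]
    exact ⟨x, by simpa using hU x⟩
  · intro x
    have := hab x
    rw [Scheme.Opens.ι_appTop] at this
    exact this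

lemma exists_gluing {T : Scheme.{u}} {ι : Type u} (U : ι → T.Opens) (hU : ∀ x, ∃ i, x ∈ U i)
    (s : ι → Γ(T, ⊤)) (hs : ∀ i j, s i |_ (U i ⊓ U j) = s j |_ (U i ⊓ U j)) :
    ∃ a : Γ(T, ⊤), ∀ i, a |_ U i = s i |_ U i := by
  obtain ⟨a, ha, -⟩ := T.sheaf.existsUnique_gluing' U ⊤ (fun i => homOfLE le_top)
    (fun x _ => by
      rw [Opens.mem_iSup]
      exact hU x) (fun i => s i |_ U i) (fun i j => by
      have := hs i j
      change (T.presheaf.map _) (T.presheaf.map _ _) = (T.presheaf.map _) (T.presheaf.map _ _)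
      rw [← ConcreteCategory.comp_apply, ← ConcreteCategory.comp_apply, ← Functor.map_comp,
        ← Functor.map_comp]
      exact this)
  exact ⟨a, ha⟩

end LocalSections

/-! ### Spectra of algebras as test objects over an affine base. -/

section AffinePoints

/-- The identification of a ring with the global sections of its spectrum. -/
def toΓ (R : Type u) [CommRing R] : R ≃+* Γ(Spec (CommRingCat.of R), ⊤) :=
  (Scheme.ΓSpecIso (CommRingCat.of R)).symm.commRingCatIsoToRingEquiv

variable {S : Scheme.{u}} {A : Type u} [CommRing A] (π : S ⟶ Spec (CommRingCat.of A))

/-- The algebra structure on the global sections of a scheme over `S`. -/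
def structMap (Z : Over S) : A →+* Γ(Z.left, ⊤) :=
  (Z.hom ≫ π).appTop.hom.comp (toΓ A : A →+* _)

lemma appTop_structMap {Z Z' : Over S} (g : Z' ⟶ Z) (a : A) :
    g.left.appTop (structMap π Z a) = structMap π Z' a := by
  have h : Z'.hom ≫ π = g.left ≫ Z.hom ≫ π := by rw [Over.w_assoc]
  simp only [structMap]
  rw [h, Scheme.Hom.comp_appTop g.left]
  rfl

lemma toΓ_naturality {R R' : Type u} [CommRing R] [CommRing R'] (g : R →+* R') (x : R) :
    (Spec.map (CommRingCat.ofHom g)).appTop (toΓ R x) = toΓ R' (g x) :=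
  (ConcreteCategory.congr_hom (Scheme.ΓSpecIso_inv_naturality (CommRingCat.ofHom g)) x).symm

variable [IsIso π] {R R' : Type u} [CommRing R] [CommRing R']

/-- The spectrum of an algebra, as a scheme over `S`. -/
def affPt (r : A →+* R) : Over S := Over.mk (Spec.map (CommRingCat.ofHom r) ≫ inv π)

instance (r : A →+* R) : IsAffine (affPt π r).left :=
  inferInstanceAs (IsAffine (Spec (CommRingCat.of R)))

/-- The identification of an algebra with the global sections of its spectrum over `S`. -/
def affΓ (r : A →+* R) : R ≃+* Γ((affPt π r).left, ⊤) := toΓ R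

lemma structMap_affPt (r : A →+* R) (a : A) :
    structMap π (affPt π r) a = affΓ π r (r a) := by
  have h : (Spec.map (CommRingCat.ofHom r) ≫ inv π) ≫ π = Spec.map (CommRingCat.ofHom r) := by
    simp
  have h' : (affPt π r).hom ≫ π = Spec.map (CommRingCat.ofHom r) := h
  simp only [structMap]
  rw [h']
  exact toΓ_naturality r a

/-- Morphisms into the spectrum of an algebra. -/
def toAffPt {Z : Over S} (r : A →+* R) (g : R →+* Γ(Z.left, ⊤))
    (hg : g.comp r = structMap π Z) : Z ⟶ affPt π r :=
  Over.homMk (Z.left.toSpecΓ ≫ Spec.map (CommRingCat.ofHom g)) <| by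
    change (_ ≫ _) ≫ Spec.map _ ≫ inv π = _
    have h : CommRingCat.ofHom (structMap π Z) =
      (Scheme.ΓSpecIso (CommRingCat.of A)).inv ≫ (Z.hom ≫ π).appTop := rfl
    rw [← Category.assoc, IsIso.comp_inv_eq, Category.assoc, ← Spec.map_comp,
      ← CommRingCat.ofHom_comp, hg, h, Spec.map_comp, ← Scheme.toSpecΓ_naturality_assoc,
      toSpecΓ_SpecMap_ΓSpecIso_inv, Category.comp_id]

lemma toAffPt_appTop {Z : Over S} (r : A →+* R) (g : R →+* Γ(Z.left, ⊤))
    (hg : g.comp r = structMap π Z) (x : R) :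
    (toAffPt π r g hg).left.appTop (affΓ π r x) = g x := by
  have h : (Z.left.toSpecΓ ≫ Spec.map (CommRingCat.ofHom g)).appTop =
      (Spec.map (CommRingCat.ofHom g)).appTop ≫ Z.left.toSpecΓ.appTop :=
    Scheme.Hom.comp_appTop _ _
  refine (ConcreteCategory.congr_hom h (toΓ R x)).trans ?_
  rw [ConcreteCategory.comp_apply, toΓ_naturality, Scheme.toSpecΓ_appTop]
  exact (toΓ Γ(Z.left, ⊤)).symm_apply_apply (g x)

/-- The morphism of spectra over `S` given by a homomorphism of algebras. -/
def affMap {r : A →+* R} {r' : A →+* R'} (g : R →+* R') (hg : g.comp r = r') :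
    affPt π r' ⟶ affPt π r :=
  toAffPt π r ((affΓ π r' : R' →+* Γ((affPt π r').left, ⊤)).comp g) <| by
    ext a
    rw [structMap_affPt, ← hg]
    rfl

lemma affMap_appTop {r : A →+* R} {r' : A →+* R'} (g : R →+* R') (hg : g.comp r = r') (x : R) :
    (affMap π g hg).left.appTop (affΓ π r x) = affΓ π r' (g x) :=
  toAffPt_appTop π r _ _ x

end AffinePoints

/-! ### Functions on a formal Lie group as power series. -/

section Functions

/-- The coordinate function. -/
def Coordinate.fn {S : Scheme.{u}} {X : GroupSheaf S} (c : Coordinate X) : functions X :=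
  ⟨fun Z x => (c.equiv Z x).1, fun _ _ g x => c.equiv_map g x⟩

lemma Coordinate.fn_mem {S : Scheme.{u}} {X : GroupSheaf S} (c : Coordinate X) :
    c.fn ∈ augmentationIdeal X := fun Z => c.equiv_zero Z

lemma Coordinate.ext_of_fn_eq {S : Scheme.{u}} {X : GroupSheaf S} (c : Coordinate X) {Z : Over S}
    {x y : X.obj.obj (op Z)} (h : c.fn.1 Z x = c.fn.1 Z y) : x = y :=
  (c.equiv Z).injective (Subtype.ext h)

/-- An open subscheme of a scheme over `S`. -/
def openOver {S : Scheme.{u}} (Z : Over S) (U : Z.left.Opens) : Over S := Over.mk (U.ι ≫ Z.hom)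

/-- The inclusion of an open subscheme of a scheme over `S`. -/
def openOverι {S : Scheme.{u}} (Z : Over S) (U : Z.left.Opens) : openOver Z U ⟶ Z :=
  Over.homMk U.ι rfl

lemma functions_apply_eq_of_locally {S : Scheme.{u}} {X Y : GroupSheaf S} {φ : functions X}
    {ψ : functions Y} {Z : Over S} {x : X.obj.obj (op Z)} {y : Y.obj.obj (op Z)}
    (h : ∀ z : Z.left, ∃ U : Z.left.Opens, z ∈ U ∧
      φ.1 _ (X.obj.map (openOverι Z U).op x) = ψ.1 _ (Y.obj.map (openOverι Z U).op y)) :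
    φ.1 Z x = ψ.1 Z y := by
  refine eq_of_locally_eq fun z => ?_
  obtain ⟨U, hz, hU⟩ := h z
  refine ⟨U, hz, ?_⟩
  rw [φ.2, ψ.2] at hU
  exact hU

/-- Allowing every `V ≤ U` lets the neighbourhoods belonging to two points be intersected. -/
lemma Coordinate.exists_isNilpotent {S : Scheme.{u}} {X : GroupSheaf S} (c : Coordinate X)
    {Z : Over S} (x : X.obj.obj (op Z)) (z : Z.left) : ∃ U : Z.left.Opens, z ∈ U ∧
      ∀ V ≤ U, IsNilpotent (c.fn.1 _ (X.obj.map (openOverι Z V).op x)) := by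
  obtain ⟨U, hz, hU⟩ := (c.equiv Z x).2 z
  refine ⟨U, hz, fun V hV => ?_⟩
  rw [c.fn.2]
  change IsNilpotent (V.ι.appTop (c.equiv Z x).1)
  rw [ι_appTop_eq_restrict]
  refine IsNilpotent.map ?_ (Z.left.presheaf.map _).hom
  have h : (c.equiv Z x).1 |_ V = Z.left.presheaf.map (homOfLE hV).op ((c.equiv Z x).1 |_ U) :=
    ConcreteCategory.congr_hom (Z.left.presheaf.map_comp (homOfLE (le_top : U ≤ ⊤)).op
      (homOfLE hV).op) (c.equiv Z x).1
  rw [h]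
  exact hU.map (Z.left.presheaf.map _).hom

lemma Coordinate.functions_ext {S : Scheme.{u}} {X : GroupSheaf S} (c : Coordinate X)
    {φ ψ : functions X} (h : ∀ (Z : Over S) (x : X.obj.obj (op Z)), IsNilpotent (c.fn.1 Z x) →
      φ.1 Z x = ψ.1 Z x) : φ = ψ := by
  refine Subtype.ext (funext fun Z => funext fun x => functions_apply_eq_of_locally fun z => ?_)
  obtain ⟨U, hz, hU⟩ := c.exists_isNilpotent x z
  exact ⟨U, hz, h _ _ (hU U le_rfl)⟩

variable {S : Scheme.{u}} {A : Type u} [CommRing A] (π : S ⟶ Spec (CommRingCat.of A)) [IsIso π]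
  {R R' : Type u} [CommRing R] [CommRing R'] {X : GroupSheaf S}

/-- The values of functions at a point with values in an algebra. -/
def ev (r : A →+* R) (x : X.obj.obj (op (affPt π r))) : functions X →+* R :=
  ((affΓ π r).symm : Γ((affPt π r).left, ⊤) →+* R).comp
    (((Pi.evalRingHom _ x).comp (Pi.evalRingHom _ (affPt π r))).comp (functions X).subtype)

lemma affΓ_ev (r : A →+* R) (x : X.obj.obj (op (affPt π r))) (φ : functions X) :
    affΓ π r (ev π r x φ) = φ.1 _ x := (affΓ π r).apply_symm_apply _

lemma ev_map {r : A →+* R} {r' : A →+* R'} (g : R →+* R') (hg : g.comp r = r')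
    (x : X.obj.obj (op (affPt π r))) (φ : functions X) :
    ev π r' (X.obj.map (affMap π g hg).op x) φ = g (ev π r x φ) := by
  apply (affΓ π r').injective
  rw [affΓ_ev, φ.2, ← affΓ_ev π r, affMap_appTop]

/-- The point with values in an algebra with a given nilpotent coordinate. -/
def Coordinate.pt (c : Coordinate X) (r : A →+* R) (a : R) (ha : IsNilpotent a) :
    X.obj.obj (op (affPt π r)) :=
  (c.equiv _).symm ⟨affΓ π r a, isLocallyNilpotent_of_isNilpotent (ha.map (affΓ π r))⟩

@[simp] lemma Coordinate.ev_pt (c : Coordinate X) (r : A →+* R) (a : R) (ha : IsNilpotent a) :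
    ev π r (c.pt π r a ha) c.fn = a := by
  apply (affΓ π r).injective
  rw [affΓ_ev]
  exact congrArg Subtype.val ((c.equiv (affPt π r)).apply_symm_apply _)

lemma Coordinate.pt_ev (c : Coordinate X) (r : A →+* R) (x : X.obj.obj (op (affPt π r)))
    {a : R} (ha : IsNilpotent a) (h : ev π r x c.fn = a) : c.pt π r a ha = x := by
  apply c.ext_of_fn_eq
  rw [← affΓ_ev, ← affΓ_ev, c.ev_pt π, h]

lemma Coordinate.isNilpotent_ev (c : Coordinate X) (r : A →+* R)
    (x : X.obj.obj (op (affPt π r))) : IsNilpotent (ev π r x c.fn) :=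
  (IsLocallyNilpotent.isNilpotent (c.equiv _ x).2).map (affΓ π r).symm

lemma Coordinate.map_pt (c : Coordinate X) {r : A →+* R} {r' : A →+* R'} (g : R →+* R')
    (hg : g.comp r = r') (a : R) (ha : IsNilpotent a) :
    X.obj.map (affMap π g hg).op (c.pt π r a ha) = c.pt π r' (g a) (ha.map g) :=
  (c.pt_ev π r' _ _ (by rw [ev_map, c.ev_pt π])).symm

/-- The coefficients of a function, as a power series in the coordinate. -/
def Coordinate.coeffs (c : Coordinate X) (φ : functions X) (i : ℕ) : A :=
  Trunc.coeff i (ev π (Trunc.C (i + 1) A) (c.pt π _ (Trunc.t (i + 1) A)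
    (Trunc.isNilpotent_t _)) φ)

/-- Coefficients are read off at varying truncation levels. They are consistent because `A[t] / (t ^
n) → A[t] / (t ^ (i + 1))` carries universal point to universal point. -/
lemma Coordinate.ev_univ (c : Coordinate X) (φ : functions X) (n : ℕ) :
    ev π (Trunc.C n A) (c.pt π _ (Trunc.t n A) (Trunc.isNilpotent_t _)) φ =
      ∑ i ∈ Finset.range n, Trunc.C n A (c.coeffs π φ i) * Trunc.t n A ^ i := by
  conv_lhs => rw [← Trunc.sum_coeff (ev π _ _ φ)]
  refine Finset.sum_congr rfl fun i hi => ?_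
  congr 2
  have hi' := Finset.mem_range.1 hi
  have ht : Trunc.t (i + 1) A ^ n = 0 := pow_eq_zero_of_le (by omega) (Trunc.t_pow (i + 1))
  have h := ev_map π _ (Trunc.lift_comp_C (Trunc.C (i + 1) A) _ ht)
    (c.pt π _ (Trunc.t n A) (Trunc.isNilpotent_t _)) φ
  rw [c.map_pt π] at h
  simp only [Trunc.lift_t] at h
  rw [← Trunc.sum_coeff (ev π _ (c.pt π _ (Trunc.t n A) (Trunc.isNilpotent_t _)) φ),
    ← Trunc.sum_coeff (ev π _ (c.pt π _ (Trunc.t (i + 1) A) (Trunc.isNilpotent_t _)) φ)] at h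
  simp only [map_sum, map_mul, map_pow, Trunc.lift_C, Trunc.lift_t] at h
  rw [← Trunc.eval₂_sum, ← Trunc.eval₂_sum] at h
  have h' := Trunc.coeff_eq_of_eval₂_eq h (Nat.lt_succ_self i)
  rw [coeff_sum_range, coeff_sum_range, if_pos (Nat.lt_succ_self i), if_pos hi'] at h'
  exact h'.symm

/-- This is Yoneda: a point whose coordinate has vanishing `n`-th power is the pullback of the
universal point along `t ↦` coordinate. -/
lemma Coordinate.apply_eq (c : Coordinate X) (φ : functions X) (Z : Over S)
    (x : X.obj.obj (op Z)) {n : ℕ} (hx : c.fn.1 Z x ^ n = 0) :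
    φ.1 Z x = ∑ i ∈ Finset.range n, structMap π Z (c.coeffs π φ i) * c.fn.1 Z x ^ i := by
  set f := toAffPt π (Trunc.C n A) (Trunc.lift (structMap π Z) _ hx) (Trunc.lift_comp_C _ _ hx)
    with hf
  have hxu : x = X.obj.map f.op (c.pt π _ (Trunc.t n A) (Trunc.isNilpotent_t _)) := by
    apply c.ext_of_fn_eq
    rw [c.fn.2, ← affΓ_ev, c.ev_pt π, hf, toAffPt_appTop, Trunc.lift_t]
  have h : φ.1 Z x = f.left.appTop (φ.1 _ (c.pt π _ (Trunc.t n A) (Trunc.isNilpotent_t _))) := by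
    rw [← φ.2, ← hxu]
  rw [h, ← affΓ_ev, hf, toAffPt_appTop, c.ev_univ π]
  simp only [map_sum, map_mul, map_pow, Trunc.lift_C, Trunc.lift_t]

lemma Coordinate.ev_eq (c : Coordinate X) (φ : functions X) (r : A →+* R)
    (x : X.obj.obj (op (affPt π r))) {n : ℕ} (hx : ev π r x c.fn ^ n = 0) :
    ev π r x φ = ∑ i ∈ Finset.range n, r (c.coeffs π φ i) * ev π r x c.fn ^ i := by
  apply (affΓ π r).injective
  have hx' : c.fn.1 _ x ^ n = 0 := by
    rw [← affΓ_ev, ← map_pow, hx, map_zero]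
  rw [affΓ_ev, c.apply_eq π φ _ x hx']
  simp only [map_sum, map_mul, map_pow, affΓ_ev, structMap_affPt]

/-- The coefficients of a function are determined by its values. -/
lemma Coordinate.coeffs_eq (c : Coordinate X) {φ : functions X} {a : ℕ → A}
    (h : ∀ (Z : Over S) (x : X.obj.obj (op Z)) (n : ℕ), c.fn.1 Z x ^ n = 0 →
      φ.1 Z x = ∑ i ∈ Finset.range n, structMap π Z (a i) * c.fn.1 Z x ^ i) :
    c.coeffs π φ = a := by
  funext i
  refine Trunc.sum_injective (n := i + 1) ?_ (Nat.lt_succ_self i)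
  rw [← c.ev_univ π]
  apply (affΓ π _).injective
  rw [affΓ_ev, h _ _ (i + 1)]
  · simp only [map_sum, map_mul, map_pow, ← affΓ_ev, structMap_affPt, c.ev_pt π]
  · rw [← affΓ_ev, c.ev_pt π, ← map_pow, Trunc.t_pow, map_zero]

lemma Coordinate.functions_ext_coeffs (c : Coordinate X) {φ ψ : functions X}
    (h : c.coeffs π φ = c.coeffs π ψ) : φ = ψ := by
  refine c.functions_ext fun Z x ⟨n, hn⟩ => ?_
  rw [c.apply_eq π φ Z x hn, c.apply_eq π ψ Z x hn, h]

lemma sum_range_eq_of_pow_eq_zero {B : Type*} [CommRing B] (a : ℕ → B) {b : B} {m n : ℕ}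
    (hm : b ^ m = 0) (hn : b ^ n = 0) :
    ∑ i ∈ Finset.range m, a i * b ^ i = ∑ i ∈ Finset.range n, a i * b ^ i := by
  wlog hmn : m ≤ n generalizing m n
  · exact (this hn hm (le_of_not_ge hmn)).symm
  refine Finset.sum_subset (Finset.range_mono hmn) fun i _ hi => ?_
  rw [pow_eq_zero_of_le (by simpa using hi) hm, mul_zero]

omit [IsIso π] in
/-- A power series can be evaluated at locally nilpotent sections. -/
lemma exists_eval (a : ℕ → A) (Z : Over S) {b : Γ(Z.left, ⊤)} (hb : IsLocallyNilpotent Z.left b) :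
    ∃ s : Γ(Z.left, ⊤), ∀ (Z' : Over S) (g : Z' ⟶ Z) (n : ℕ), g.left.appTop b ^ n = 0 →
      g.left.appTop s = ∑ i ∈ Finset.range n, structMap π Z' (a i) * g.left.appTop b ^ i := by
  choose U hU n hn using hb
  -- The nilpotency exponent varies with the neighbourhood, so truncated sums are glued; on an
  -- overlap both exponents kill `b`, and the truncations agree.
  obtain ⟨s, hs⟩ := exists_gluing U (fun x => ⟨x, hU x⟩)
    (fun x => ∑ i ∈ Finset.range (n x), structMap π Z (a i) * b ^ i) (fun x y => by
      have hb' : ∀ x V, V ≤ U x → (Z.left.presheaf.map (homOfLE (le_top : V ≤ ⊤)).op b) ^ n x = 0 := by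
        intro x V hV
        have h : Z.left.presheaf.map (homOfLE (le_top : V ≤ ⊤)).op b =
            Z.left.presheaf.map (homOfLE hV).op (b |_ U x) :=
          ConcreteCategory.congr_hom (Z.left.presheaf.map_comp (homOfLE (le_top : U x ≤ ⊤)).op
            (homOfLE hV).op) b
        rw [h, ← map_pow, hn, map_zero]
      change Z.left.presheaf.map (homOfLE (le_top : U x ⊓ U y ≤ ⊤)).op _ =
        Z.left.presheaf.map (homOfLE (le_top : U x ⊓ U y ≤ ⊤)).op _
      simp only [map_sum, map_mul, map_pow]
      exact sum_range_eq_of_pow_eq_zero _ (hb' x _ inf_le_left) (hb' y _ inf_le_right))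
  refine ⟨s, fun Z' g m hm => eq_of_locally_eq fun z => ?_⟩
  set x := g.left z with hx
  refine ⟨g.left ⁻¹ᵁ U x, hU x, ?_⟩
  have key : ∀ u v : Γ(Z.left, ⊤), u |_ U x = v |_ U x →
      (g.left ⁻¹ᵁ U x).ι.appTop (g.left.appTop u) =
        (g.left ⁻¹ᵁ U x).ι.appTop (g.left.appTop v) := by
    intro u v huv
    have hc : ∀ w, (g.left ⁻¹ᵁ U x).ι.appTop (g.left.appTop w) =
        (g.left ∣_ U x).appTop ((U x).ι.appTop w) := by
      intro w
      have h := congrArg Scheme.Hom.appTop (morphismRestrict_ι g.left (U x))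
      rw [Scheme.Hom.comp_appTop, Scheme.Hom.comp_appTop] at h
      exact (ConcreteCategory.congr_hom h w).symm
    rw [hc, hc, ι_appTop_eq_restrict, ι_appTop_eq_restrict, huv]
  have hb0 : (b ^ n x) |_ U x = (0 : Γ(Z.left, ⊤)) |_ U x :=
    (map_pow (Z.left.presheaf.map _).hom b (n x)).trans ((hn x).trans (map_zero _).symm)
  have h1 := key _ _ hb0
  simp only [map_pow, map_zero] at h1
  rw [key _ _ (hs x)]
  simp only [map_sum, map_mul, map_pow]
  simp only [appTop_structMap]
  exact sum_range_eq_of_pow_eq_zero _ h1 (by rw [← map_pow, hm, map_zero])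

/-- Every power series in the coordinate defines a function. -/
lemma Coordinate.exists_function (c : Coordinate X) (a : ℕ → A) :
    ∃ φ : functions X, c.coeffs π φ = a := by
  choose s hs using fun (Z : Over S) (x : X.obj.obj (op Z)) => exists_eval π a Z (c.equiv Z x).2
  refine ⟨⟨s, fun Z Z' g x => ?_⟩, c.coeffs_eq π fun Z x n hn => ?_⟩
  -- Where the coordinate is nilpotent, both sides are the same truncated sum.
  · refine eq_of_locally_eq fun z => ?_
    obtain ⟨U, hz, hU⟩ := c.exists_isNilpotent (X.obj.map g.op x) z
    obtain ⟨n, hn⟩ := hU U le_rfl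
    refine ⟨U, hz, ?_⟩
    have hcomp : ∀ w, (openOverι Z' U ≫ g).left.appTop w =
        (openOverι Z' U).left.appTop (g.left.appTop w) :=
      ConcreteCategory.congr_hom (Scheme.Hom.comp_appTop (openOverι Z' U).left g.left)
    have h1 := hs Z' (X.obj.map g.op x) _ (openOverι Z' U) n
    have h2 := hs Z x _ (openOverι Z' U ≫ g) n
    rw [c.fn.2] at hn
    rw [hcomp, hcomp] at h2
    rw [c.equiv_map] at h1
    have hn' : (openOverι Z' U).left.appTop (g.left.appTop (c.equiv Z x).1) ^ n = 0 := by
      rw [← c.equiv_map]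
      exact hn
    exact (h1 hn').trans (h2 hn').symm
  · have hid : ∀ w, (𝟙 Z : Z ⟶ Z).left.appTop w = w :=
      ConcreteCategory.congr_hom Scheme.Hom.id_appTop
    have h := hs Z x Z (𝟙 Z) n
    rw [hid, hid] at h
    exact h hn

end Functions

lemma Trunc.exists_eq {A : Type u} [CommRing A] {n : ℕ} (x : Trunc n A) :
    ∃ a y, x = C n A a + t n A * y := by
  obtain ⟨P, rfl⟩ := Ideal.Quotient.mk_surjective x
  refine ⟨P.coeff 0, Ideal.Quotient.mk _ P.divX, ?_⟩
  conv_lhs => rw [← P.divX_mul_X_add]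
  rw [map_add, map_mul, add_comm, mul_comm]
  rfl

lemma Trunc.eq_zero_of_C_mul_t_pow {A : Type u} [CommRing A] {n : ℕ} {a : A} {i : ℕ} (hi : i < n)
    (h : C n A a * t n A ^ i = 0) : a = 0 := by
  have h' : (Polynomial.C a * Polynomial.X ^ i : Polynomial A).eval₂ (C n A) (t n A) =
      (0 : Polynomial A).eval₂ (C n A) (t n A) := by
    simpa using h
  simpa using coeff_eq_of_eval₂_eq h' hi

/-! ### Powers of the augmentation ideal in terms of coefficients. -/

section Powers

variable {S : Scheme.{u}} {A : Type u} [CommRing A] (π : S ⟶ Spec (CommRingCat.of A)) [IsIso π]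
  {X : GroupSheaf S} (c : Coordinate X)

lemma ev_zero {R : Type u} [CommRing R] (r : A →+* R) {φ : functions X}
    (hφ : φ ∈ augmentationIdeal X) : ev π r (0 : X.obj.obj (op (affPt π r))) φ = 0 := by
  apply (affΓ π r).injective
  rw [affΓ_ev, map_zero]
  exact hφ _

lemma Coordinate.pt_zero {R : Type u} [CommRing R] (r : A →+* R) :
    c.pt π r 0 IsNilpotent.zero = 0 :=
  c.pt_ev π r 0 IsNilpotent.zero (ev_zero π r c.fn_mem)

lemma Coordinate.coeffs_zero {φ : functions X} (hφ : φ ∈ augmentationIdeal X) :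
    c.coeffs π φ 0 = 0 := by
  have h := c.ev_eq π φ (RingHom.id A) 0 (n := 1) (by rw [ev_zero π _ c.fn_mem, zero_pow one_ne_zero])
  rw [ev_zero π _ hφ] at h
  simpa using h.symm

/-- Evaluation at the universal point modulo `t ^ (i + 1)` sends the augmentation ideal into `(t)`,
so its `m`-th power goes to zero when `i < m`. -/
lemma Coordinate.coeffs_eq_zero_of_mem_pow {φ : functions X} {m : ℕ}
    (hφ : φ ∈ augmentationIdeal X ^ m) {i : ℕ} (hi : i < m) : c.coeffs π φ i = 0 := by
  set e := ev π _ (c.pt π (Trunc.C (i + 1) A) (Trunc.t (i + 1) A) (Trunc.isNilpotent_t _)) with he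
  have h1 : (augmentationIdeal X).map e ≤ Ideal.span {Trunc.t (i + 1) A} := by
    rw [Ideal.map_le_iff_le_comap]
    intro ψ hψ
    rw [Ideal.mem_comap, Ideal.mem_span_singleton, he, c.ev_univ π]
    refine Finset.dvd_sum fun j _ => ?_
    rcases Nat.eq_zero_or_pos j with rfl | hj
    · rw [c.coeffs_zero π hψ, map_zero, zero_mul]
      exact dvd_zero _
    · exact Dvd.dvd.mul_left (dvd_pow_self _ hj.ne') _
  have h2 := Ideal.mem_map_of_mem e hφ
  rw [Ideal.map_pow] at h2
  have h3 := Ideal.pow_right_mono h1 m h2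
  rw [Ideal.span_singleton_pow, Ideal.mem_span_singleton,
    pow_eq_zero_of_le hi (Trunc.t_pow (i + 1)), zero_dvd_iff, he, c.ev_univ π] at h3
  refine Trunc.sum_injective (n := i + 1) (b := 0) ?_ (Nat.lt_succ_self i)
  rw [h3]
  simp

/-- The cofactor is the shifted series. Together with `coeffs_eq_zero_of_mem_pow`, this describes
powers of the ideal by vanishing coefficients. -/
lemma Coordinate.exists_eq_pow_mul {φ : functions X} {m : ℕ}
    (h : ∀ i < m, c.coeffs π φ i = 0) : ∃ ψ, φ = c.fn ^ m * ψ := by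
  obtain ⟨ψ, hψ⟩ := c.exists_function π fun i => c.coeffs π φ (m + i)
  refine ⟨ψ, c.functions_ext fun Z x ⟨n, hn⟩ => ?_⟩
  change φ.1 Z x = c.fn.1 Z x ^ m * ψ.1 Z x
  rw [c.apply_eq π ψ Z x hn, hψ, c.apply_eq π φ Z x (pow_eq_zero_of_le (Nat.le_add_left n m) hn),
    Finset.sum_range_add, Finset.sum_eq_zero, zero_add, Finset.mul_sum]
  · refine Finset.sum_congr rfl fun i _ => ?_
    ring
  · intro i hi
    rw [h i (Finset.mem_range.1 hi), map_zero, zero_mul]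

end Powers

/-! ### Base change of coefficients and the height condition. -/

section BaseChange

variable {S S' : Scheme.{u}} {X : GroupSheaf S}

/-- Base change of a function. -/
def restrictFn (f : S' ⟶ S) (φ : functions X) : functions ((restrict f).obj X) :=
  ⟨fun Z x => φ.1 ((Over.map f).obj Z) x, fun _ _ g x => φ.2 ((Over.map f).map g) x⟩

lemma structMap_map {A A' : Type u} [CommRing A] [CommRing A'] (π : S ⟶ Spec (CommRingCat.of A))
    (π' : S' ⟶ Spec (CommRingCat.of A')) (f : S' ⟶ S) (g : A →+* A')
    (hf : f ≫ π = π' ≫ Spec.map (CommRingCat.ofHom g)) (Z : Over S') (a : A) :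
    structMap π ((Over.map f).obj Z) a = structMap π' Z (g a) := by
  have h : ((Over.map f).obj Z).hom ≫ π = (Z.hom ≫ π') ≫ Spec.map (CommRingCat.ofHom g) := by
    rw [Over.map_obj_hom, Category.assoc, hf, Category.assoc]
  have h2 := congrArg Scheme.Hom.appTop h
  rw [Scheme.Hom.comp_appTop (Z.hom ≫ π')] at h2
  refine (ConcreteCategory.congr_hom h2 (toΓ A a)).trans ?_
  rw [ConcreteCategory.comp_apply, toΓ_naturality]
  rfl

lemma Coordinate.coeffs_restrictFn {A A' : Type u} [CommRing A] [CommRing A']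
    (π : S ⟶ Spec (CommRingCat.of A)) (π' : S' ⟶ Spec (CommRingCat.of A')) [IsIso π] [IsIso π']
    (f : S' ⟶ S) (g : A →+* A') (hf : f ≫ π = π' ≫ Spec.map (CommRingCat.ofHom g))
    (c : Coordinate X) (φ : functions X) (i : ℕ) :
    (c.restrict f).coeffs π' (restrictFn f φ) i = g (c.coeffs π φ i) := by
  refine congrFun ((c.restrict f).coeffs_eq π' (a := fun i => g (c.coeffs π φ i))
    fun Z x n hn => ?_) i
  refine (c.apply_eq π φ ((Over.map f).obj Z) x hn).trans ?_
  simp only [structMap_map π π' f g hf]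
  rfl

lemma restrictFn_mulPullback (f : S' ⟶ S) (m : ℕ) (c : Coordinate X) :
    restrictFn f (mulPullback m X c.fn) = mulPullback m _ (c.restrict f).fn := rfl

lemma mulPullback_mem {m : ℕ} {φ : functions X} (hφ : φ ∈ augmentationIdeal X) :
    mulPullback m X φ ∈ augmentationIdeal X := fun Z => by
  change φ.1 Z (m • 0) = 0
  rw [smul_zero]
  exact hφ Z

lemma HeightGE.coeffs_eq_zero {A : Type u} [CommRing A] (π : S ⟶ Spec (CommRingCat.of A)) [IsIso π]
    (c : Coordinate X) {p h : ℕ} (hX : HeightGE p h S X) {i : ℕ} (hi : i < p ^ h) :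
    c.coeffs π (mulPullback p X c.fn) i = 0 := by
  have : IsAffine S := .of_isIso π
  have h1 := hX S (𝟙 S) _ (c.restrict (𝟙 S)).fn_mem
  rw [← restrictFn_mulPullback] at h1
  have h2 := (c.restrict (𝟙 S)).coeffs_eq_zero_of_mem_pow π h1 hi
  rwa [c.coeffs_restrictFn π π (𝟙 S) (RingHom.id A) (by
    rw [Category.id_comp]
    exact ((congrArg (π ≫ ·) (Spec.map_id (CommRingCat.of A))).trans (Category.comp_id π)).symm)] at h2

/-- Every function in the augmentation ideal is a multiple of the coordinate, and `[p]^*` is a ring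
homomorphism, so testing the coordinate suffices, after any affine base change. -/
lemma heightGE_of_coeffs_eq_zero {A : Type u} [CommRing A] (π : S ⟶ Spec (CommRingCat.of A))
    [IsIso π] (c : Coordinate X) {p h : ℕ}
    (hc : ∀ i < p ^ h, c.coeffs π (mulPullback p X c.fn) i = 0) : HeightGE p h S X := by
  intro T _ f φ hφ
  set π' : T ⟶ Spec (CommRingCat.of Γ(T, ⊤)) := T.toSpecΓ with hπ'
  have : IsIso π' := inferInstanceAs (IsIso T.toSpecΓ)
  set c' := c.restrict f
  have hf : f ≫ π = π' ≫ Spec.map (CommRingCat.ofHom (structMap π (Over.mk f))) := by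
    have h : CommRingCat.ofHom (structMap π (Over.mk f)) =
      (Scheme.ΓSpecIso (CommRingCat.of A)).inv ≫ (f ≫ π).appTop := rfl
    rw [h, Spec.map_comp]
    refine Eq.trans ?_ (Scheme.toSpecΓ_naturality_assoc (f ≫ π) _)
    rw [toSpecΓ_SpecMap_ΓSpecIso_inv, Category.comp_id]
  obtain ⟨ψ, hψ⟩ := c'.exists_eq_pow_mul π' (φ := φ) (m := 1) (fun i hi => by
    rw [Nat.lt_one_iff.1 hi]
    exact c'.coeffs_zero π' hφ)
  obtain ⟨w, hw⟩ := c'.exists_eq_pow_mul π' (φ := mulPullback p _ c'.fn) (m := p ^ h)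
    (fun i hi => by
      have := c.coeffs_restrictFn π π' f _ hf (mulPullback p X c.fn) i
      rw [hc i hi, map_zero] at this
      exact this)
  rw [hψ, pow_one, map_mul, hw]
  exact Ideal.mul_mem_right _ _ (Ideal.mul_mem_right _ _ (Ideal.pow_mem_pow c'.fn_mem _))

end BaseChange

/-! ### Multiplication by `p` in characteristic `p`. -/

/-- The algebraic core of the vanishing of the derivative of multiplication by `p`. -/
lemma eq_zero_of_sum_eq {A : Type u} [CommRing A] {p k l q n : ℕ} (hp : p.Prime)
    (hpA : (p : A) = 0) (hpl : ¬ p ∣ l) (hq : q = p ^ k) (hn : n = q * l) (b : ℕ → A) {N : ℕ}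
    (hN : l < N) {y : Trunc n A} {P z : Trunc (2 * q) (Trunc n A)}
    (hP : P = Trunc.C (2 * q) _ (Trunc.t n A) +
      Trunc.C (2 * q) _ (1 + Trunc.t n A * y) * Trunc.t (2 * q) _ + Trunc.t (2 * q) _ ^ 2 * z)
    (h : ∑ i ∈ Finset.range N, ((Trunc.C (2 * q) _).comp (Trunc.C n A)) (b i) * (P ^ q) ^ i =
      ∑ i ∈ Finset.range N, ((Trunc.C (2 * q) _).comp (Trunc.C n A)) (b i) *
        (Trunc.C (2 * q) _ (Trunc.t n A) ^ q) ^ i) : b l = 0 := by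
  have hq0 : 0 < q := hq ▸ pow_pos hp.pos k
  have hl : l ≠ 0 := by
    rintro rfl
    exact hpl (dvd_zero p)
  have heval : ∀ w : Trunc (2 * q) (Trunc n A),
      ∑ i ∈ Finset.range N, ((Trunc.C (2 * q) _).comp (Trunc.C n A)) (b i) * w ^ i =
        ((∑ i ∈ Finset.range N, Polynomial.C (b i) * Polynomial.X ^ i : Polynomial A).map
          ((Trunc.C (2 * q) _).comp (Trunc.C n A))).eval w := by
    intro w
    simp [Polynomial.eval_map, Polynomial.eval₂_finsetSum]
  rw [heval, heval] at h
  set g : Polynomial A := ∑ i ∈ Finset.range N, Polynomial.C (b i) * Polynomial.X ^ i with hg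
  generalize hω : 1 + Trunc.t n A * y = ω at hP
  have hωu : IsUnit (ω ^ q) := by
    rw [← hω]
    exact (IsNilpotent.isUnit_one_add ((Commute.all _ y).isNilpotent_mul_right
      (Trunc.isNilpotent_t n))).pow q
  have ht2 : Trunc.t (2 * q) (Trunc n A) ^ (2 * q) = 0 := Trunc.t_pow _
  have hpR : (p : Trunc (2 * q) (Trunc n A)) = 0 := by
    rw [← map_natCast ((Trunc.C (2 * q) _).comp (Trunc.C n A)), hpA, map_zero]
  -- The `q`-th power is additive as `p = 0`. The modulus `t ^ (2 * q)` kills the quadratic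
  -- remainder but keeps the term in `t ^ q`.
  have hPq : P ^ q = Trunc.C (2 * q) _ (Trunc.t n A) ^ q +
      Trunc.C (2 * q) _ ω ^ q * Trunc.t (2 * q) _ ^ q := by
    obtain ⟨u, hu⟩ := exists_add_pow_prime_pow_eq hp (Trunc.C (2 * q) _ (Trunc.t n A) +
      Trunc.C (2 * q) _ ω * Trunc.t (2 * q) _) (Trunc.t (2 * q) _ ^ 2 * z) k
    obtain ⟨v, hv⟩ := exists_add_pow_prime_pow_eq hp (Trunc.C (2 * q) _ (Trunc.t n A))
      (Trunc.C (2 * q) _ ω * Trunc.t (2 * q) _) k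
    rw [← hP, ← hq] at hu
    rw [← hq] at hv
    rw [hu, hv, mul_pow (Trunc.t (2 * q) _ ^ 2), ← pow_mul, ht2, hpR, mul_pow]
    ring
  have h0 : (Trunc.C (2 * q) _ ω ^ q * Trunc.t (2 * q) _ ^ q) ^ 2 = 0 := by
    rw [mul_pow, ← pow_mul (Trunc.t _ _), mul_comm q 2, ht2, mul_zero]
  -- First-order Taylor expansion of `g` at `T ^ q`: the hypothesis forces `g'(T ^ q) * ω ^ q * t ^
  -- q = 0`, and `ω` is a unit, being `1` plus a nilpotent.
  obtain ⟨κ, hκ⟩ := (g.map ((Trunc.C (2 * q) _).comp (Trunc.C n A))).binomExpansion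
    (Trunc.C (2 * q) _ (Trunc.t n A) ^ q) (Trunc.C (2 * q) _ ω ^ q * Trunc.t (2 * q) _ ^ q)
  rw [← hPq, h, h0, mul_zero, add_zero, left_eq_add] at hκ
  have hder : Trunc.C (2 * q) _ ((g.derivative.eval₂ (Trunc.C n A) (Trunc.t n A ^ q)) * ω ^ q) *
      Trunc.t (2 * q) _ ^ q = 0 := by
    rw [← hκ, Polynomial.derivative_map, Polynomial.eval_map, map_mul, map_pow,
      Polynomial.hom_eval₂, map_pow, mul_assoc]
  have hz := (hωu.mul_left_eq_zero).1 (Trunc.eq_zero_of_C_mul_t_pow (by omega) hder)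
  have hz' : (Polynomial.expand A q g.derivative).eval₂ (Trunc.C n A) (Trunc.t n A) =
      (0 : Polynomial A).eval₂ (Trunc.C n A) (Trunc.t n A) := by
    rw [Polynomial.eval₂_zero, ← hz, Polynomial.expand_eq_comp_X_pow, Polynomial.eval₂_comp,
      Polynomial.eval₂_X_pow]
  -- The coefficient of `g'(T ^ q)` at `(l - 1) * q` is `l * b l`; the choice `n = q * l` leaves it
  -- just visible.
  have hcoeff := Trunc.coeff_eq_of_eval₂_eq hz' (i := (l - 1) * q) (by
    rw [hn, mul_comm]
    exact Nat.mul_lt_mul_of_pos_left (by omega) hq0)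
  rw [Polynomial.coeff_expand_mul hq0, Polynomial.coeff_derivative, Nat.sub_add_cancel (by omega),
    hg, coeff_sum_range, if_pos (by omega), Polynomial.coeff_zero] at hcoeff
  have hl' : ((l - 1 : ℕ) : A) + 1 = l := by
    rw [← Nat.cast_succ, Nat.succ_eq_add_one, Nat.sub_add_cancel (by omega)]
  rw [hl'] at hcoeff
  -- A Bézout relation between `p` and `l` inverts `l`, since `p = 0` in `A`.
  obtain ⟨u, v, huv⟩ := (Nat.isCoprime_iff_coprime.2 ((Nat.Prime.coprime_iff_not_dvd hp).2 hpl))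
  have huv' := congrArg (Int.cast : ℤ → A) huv
  push_cast at huv'
  linear_combination (-b l) * huv' + (b l * u) * hpA + (v : A) * hcoeff

section Height

variable {S : Scheme.{u}} {A : Type u} [CommRing A] (π : S ⟶ Spec (CommRingCat.of A)) [IsIso π]
  {X : GroupSheaf S} (c : Coordinate X)

lemma Trunc.isNilpotent_C_t (n m : ℕ) : IsNilpotent (C m (Trunc n A) (t n A)) :=
  (isNilpotent_t n).map _

/-- The sum of two points in the universal case, to first order in the second point. -/
lemma Coordinate.exists_add_eq {n m : ℕ} (hn : 1 ≤ n) (hm : 2 ≤ m) :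
    ∃ (y : Trunc n A) (z : Trunc m (Trunc n A)),
      ev π ((Trunc.C m (Trunc n A)).comp (Trunc.C n A))
        (c.pt π _ (Trunc.C m _ (Trunc.t n A)) (Trunc.isNilpotent_C_t n m) +
          c.pt π _ (Trunc.t m _) (Trunc.isNilpotent_t m)) c.fn =
      Trunc.C m _ (Trunc.t n A) + Trunc.C m _ (1 + Trunc.t n A * y) * Trunc.t m _ +
        Trunc.t m _ ^ 2 * z := by
  set P := ev π ((Trunc.C m (Trunc n A)).comp (Trunc.C n A))
        (c.pt π _ (Trunc.C m _ (Trunc.t n A)) (Trunc.isNilpotent_C_t n m) +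
          c.pt π _ (Trunc.t m _) (Trunc.isNilpotent_t m)) c.fn with hP
  obtain ⟨a, P', hP1⟩ := Trunc.exists_eq P
  obtain ⟨a', z, hP2⟩ := Trunc.exists_eq P'
  obtain ⟨b, y, hb⟩ := Trunc.exists_eq a'
  -- Setting the second variable to zero expresses `x + 0 = x`.
  have ha : a = Trunc.t n A := by
    set e := Trunc.lift (n := m) (RingHom.id (Trunc n A)) 0 (zero_pow (by omega))
    have hcomp : e.comp ((Trunc.C m (Trunc n A)).comp (Trunc.C n A)) = Trunc.C n A := by
      ext x
      simp [e]
    have h := ev_map π e hcomp (c.pt π _ (Trunc.C m _ (Trunc.t n A)) (Trunc.isNilpotent_C_t n m) +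
          c.pt π _ (Trunc.t m _) (Trunc.isNilpotent_t m)) c.fn
    rw [map_add, c.map_pt π, c.map_pt π, ← hP, hP1] at h
    simp only [e, Trunc.lift_C, Trunc.lift_t, map_add, map_mul, c.pt_zero π, add_zero, zero_mul,
      c.ev_pt π, RingHom.id_apply] at h
    exact h.symm
  -- Setting the first variable to zero, modulo `t ^ 2`, expresses `0 + s = s` to first order.
  have hb1 : b = 1 := by
    set e' := Trunc.lift (n := n) (RingHom.id A) 0 (zero_pow (by omega))
    set e := Trunc.lift (n := m) ((Trunc.C 2 A).comp e') (Trunc.t 2 A)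
      (pow_eq_zero_of_le hm (Trunc.t_pow 2))
    have hcomp : e.comp ((Trunc.C m (Trunc n A)).comp (Trunc.C n A)) = Trunc.C 2 A := by
      ext x
      simp [e, e']
    have h := ev_map π e hcomp (c.pt π _ (Trunc.C m _ (Trunc.t n A)) (Trunc.isNilpotent_C_t n m) +
          c.pt π _ (Trunc.t m _) (Trunc.isNilpotent_t m)) c.fn
    rw [map_add, c.map_pt π, c.map_pt π, ← hP, hP1, hP2, ha, hb] at h
    simp only [e, e', Trunc.lift_C, Trunc.lift_t, map_add, map_mul, c.pt_zero π, zero_add, zero_mul,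
      c.ev_pt π, RingHom.id_apply, RingHom.comp_apply, map_zero, add_zero] at h
    have h2 : Trunc.C 2 A (b - 1) * Trunc.t 2 A ^ 1 = 0 := by
      rw [map_sub, map_one]
      linear_combination -h - Trunc.lift ((Trunc.C 2 A).comp (Trunc.lift (n := n) (RingHom.id A) 0
        (zero_pow (by omega)))) (Trunc.t 2 A) (pow_eq_zero_of_le hm (Trunc.t_pow 2)) z *
          Trunc.t_pow (A := A) 2
    exact sub_eq_zero.1 (Trunc.eq_zero_of_C_mul_t_pow (by norm_num) h2)
  refine ⟨y, z, ?_⟩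
  rw [hP1, hP2, hb, ha, hb1, map_one]
  ring

/-- Specializing the universal sum, every correction term contains `a * b` or `b ^ 2`. This gives
the additive tangent space on which `p` acts by scalar multiplication. -/
lemma Coordinate.ev_add_of_sq_eq_zero {R : Type u} [CommRing R] (r : A →+* R) {a b : R}
    (ha : a ^ 2 = 0) (hb : b ^ 2 = 0) (hab : a * b = 0) :
    ev π r (c.pt π r a ⟨2, ha⟩ + c.pt π r b ⟨2, hb⟩) c.fn = a + b := by
  obtain ⟨y, z, h⟩ := c.exists_add_eq π (n := 2) (m := 2) (by norm_num) le_rfl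
  set e' := Trunc.lift r a ha
  set e := Trunc.lift e' b hb
  have hcomp : e.comp ((Trunc.C 2 (Trunc 2 A)).comp (Trunc.C 2 A)) = r := by
    ext x
    simp [e, e']
  have h1 := ev_map π e hcomp (c.pt π _ (Trunc.C 2 _ (Trunc.t 2 A)) (Trunc.isNilpotent_C_t 2 2) +
          c.pt π _ (Trunc.t 2 _) (Trunc.isNilpotent_t 2)) c.fn
  rw [map_add, c.map_pt π, c.map_pt π, h] at h1
  simp only [e, e', Trunc.lift_C, Trunc.lift_t, map_add, map_mul, map_pow, map_one] at h1
  rw [h1]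
  linear_combination Trunc.lift r a ha y * hab + Trunc.lift (Trunc.lift r a ha) b hb z * hb

lemma Coordinate.ev_nsmul_of_sq_eq_zero {R : Type u} [CommRing R] (r : A →+* R) {a : R}
    (ha : a ^ 2 = 0) (m : ℕ) : ev π r (m • c.pt π r a ⟨2, ha⟩) c.fn = m * a := by
  induction m with
  | zero => rw [zero_smul, ev_zero π r c.fn_mem, Nat.cast_zero, zero_mul]
  | succ m ih =>
    have hma : ((m : R) * a) ^ 2 = 0 := by rw [mul_pow, ha, mul_zero]
    rw [succ_nsmul, ← c.pt_ev π r _ ⟨2, hma⟩ ih,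
      c.ev_add_of_sq_eq_zero π r hma ha (by linear_combination (m : R) * ha)]
    push_cast
    ring

lemma ev_mulPullback {R : Type u} [CommRing R] (r : A →+* R) (x : X.obj.obj (op (affPt π r)))
    (m : ℕ) (φ : functions X) : ev π r x (mulPullback m X φ) = ev π r (m • x) φ := rfl

/-- Formal Lie groups of positive height live in characteristic `p`. -/
lemma natCast_eq_zero_of_coeffs_eq_zero {p h : ℕ} (hp : p.Prime) (hh : 1 ≤ h)
    (hc : ∀ i < p ^ h, c.coeffs π (mulPullback p X c.fn) i = 0) : (p : A) = 0 := by
  have h1 := c.ev_nsmul_of_sq_eq_zero π (Trunc.C 2 A) (Trunc.t_pow 2) p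
  rw [← ev_mulPullback, c.ev_univ π, Finset.sum_eq_zero] at h1
  · refine Trunc.eq_zero_of_C_mul_t_pow (n := 2) (i := 1) (by norm_num) ?_
    rw [map_natCast, pow_one, ← h1]
  · intro i hi
    have : i < p ^ h :=
      (Finset.mem_range.1 hi).trans_le (hp.two_le.trans (Nat.le_self_pow (by omega) p))
    rw [hc i this, map_zero, zero_mul]

lemma sum_range_mul_of_dvd {B : Type*} [CommRing B] {q : ℕ} (hq : 0 < q) (M : ℕ) (f : ℕ → B)
    (hf : ∀ i, ¬ q ∣ i → f i = 0) :
    ∑ i ∈ Finset.range (q * M), f i = ∑ j ∈ Finset.range M, f (q * j) := by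
  induction M with
  | zero => simp
  | succ M ih =>
    rw [Nat.mul_succ, Finset.sum_range_add, ih, Finset.sum_range_succ]
    congr 1
    rw [Finset.sum_eq_single_of_mem 0 (Finset.mem_range.2 hq), add_zero]
    intro i hi hi0
    refine hf _ fun hd => ?_
    have h1 := Nat.le_of_dvd (Nat.pos_of_ne_zero hi0) ((Nat.dvd_add_right (dvd_mul_right q M)).1 hd)
    exact absurd h1 (not_le.2 (Finset.mem_range.1 hi))

/-- In characteristic `p`, if multiplication by `p` is a power series in `T ^ (p ^ k)` without
leading term, it is a power series in `T ^ (p ^ (k + 1))`. -/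
lemma coeffs_mulPullback_step {p : ℕ} (hp : p.Prime) (hpA : (p : A) = 0) (k : ℕ)
    (hs : ∀ j, ¬ p ^ k ∣ j → c.coeffs π (mulPullback p X c.fn) j = 0)
    (hk : c.coeffs π (mulPullback p X c.fn) (p ^ k) = 0) (j : ℕ) (hj : ¬ p ^ (k + 1) ∣ j) :
    c.coeffs π (mulPullback p X c.fn) j = 0 := by
  set a := c.coeffs π (mulPullback p X c.fn) with ha
  by_cases hqj : p ^ k ∣ j
  swap
  · exact hs j hqj
  obtain ⟨l, rfl⟩ := hqj
  have hpl : ¬ p ∣ l := fun h => hj (by rw [pow_succ]; exact mul_dvd_mul_left _ h)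
  have hl : l ≠ 0 := by
    rintro rfl
    exact hpl (dvd_zero p)
  set q := p ^ k with hq
  have hq0 : 0 < q := pow_pos hp.pos k
  have a0 : a 0 = 0 := c.coeffs_zero π (mulPullback_mem c.fn_mem)
  set n := q * l with hn
  have hn1 : 1 ≤ n := Nat.mul_pos hq0 (Nat.pos_of_ne_zero hl)
  set B := Trunc n A
  set r := (Trunc.C (2 * q) B).comp (Trunc.C n A) with hr
  set x := c.pt π r (Trunc.C (2 * q) _ (Trunc.t n A)) (Trunc.isNilpotent_C_t n (2 * q)) with hx
  set s := c.pt π r (Trunc.t (2 * q) B) (Trunc.isNilpotent_t _) with hsdef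
  set T := Trunc.C (2 * q) _ (Trunc.t n A) with hT
  set t := Trunc.t (2 * q) B with ht
  -- As `t ^ (2 * q) = 0`, only the coefficients at `0` and `q` could contribute, and both vanish.
  have hps : p • s = 0 := by
    apply c.ext_of_fn_eq
    rw [← affΓ_ev, ← affΓ_ev, ← ev_mulPullback, ev_zero π r c.fn_mem,
      c.ev_eq π _ r s (n := 2 * q) (by rw [hsdef, c.ev_pt π]; exact Trunc.t_pow _), Finset.sum_eq_zero]
    intro i hi
    have : a i = 0 := by
      by_cases hqi : q ∣ i
      · obtain ⟨m, rfl⟩ := hqi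
        have hm : m < 2 := by
          have := Finset.mem_range.1 hi
          nlinarith
        interval_cases m
        · rwa [mul_zero]
        · rwa [mul_one]
      · exact hs i hqi
    rw [← ha, this, map_zero, zero_mul]
  obtain ⟨y, z, hP⟩ := c.exists_add_eq π (n := n) (m := 2 * q) hn1 (by omega)
  set P := ev π r (x + s) c.fn with hPdef
  obtain ⟨M, hM⟩ := c.isNilpotent_ev π r (x + s)
  have hTn : T ^ n = 0 := by rw [hT, ← map_pow, Trunc.t_pow, map_zero]
  -- Large enough that both expansions may be cut off at `q * N` and that the index `l` still
  -- occurs.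
  set N := M + n + l + 1 with hN
  have hle : ∀ i, i ≤ N → i ≤ q * N := fun i hi => hi.trans (Nat.le_mul_of_pos_left N hq0)
  have hxT : ev π r x c.fn = T := c.ev_pt π r _ _
  -- Adding the `p`-torsion point `s` does not change the multiple by `p`; this is the relation
  -- differentiated in `eq_zero_of_sum_eq`.
  have heq : ev π r (x + s) (mulPullback p X c.fn) = ev π r x (mulPullback p X c.fn) := by
    rw [ev_mulPullback, ev_mulPullback, smul_add, hps, add_zero]
  rw [c.ev_eq π _ r (x + s) (pow_eq_zero_of_le (hle M (by omega)) hM),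
    c.ev_eq π _ r x (pow_eq_zero_of_le (hle n (by omega)) (hxT ▸ hTn)),
    sum_range_mul_of_dvd hq0 _ _ (fun i hi => by rw [← ha, hs i hi, map_zero, zero_mul]),
    sum_range_mul_of_dvd hq0 _ _ (fun i hi => by rw [← ha, hs i hi, map_zero, zero_mul]), hxT,
    ← ha, ← hPdef] at heq
  simp only [pow_mul] at heq
  exact eq_zero_of_sum_eq hp hpA hpl hq hn (fun i => a (q * i)) (by omega) hP heq

/-- The step from `k` to `k + 1` needs the coefficient at `p ^ k` to vanish, which the height
supplies for every `k < h`. -/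
lemma coeffs_mulPullback_of_not_dvd {p h : ℕ} (hp : p.Prime) (hh : 1 ≤ h)
    (hc : ∀ i < p ^ h, c.coeffs π (mulPullback p X c.fn) i = 0) {k : ℕ} (hk : k ≤ h) (j : ℕ)
    (hj : ¬ p ^ k ∣ j) : c.coeffs π (mulPullback p X c.fn) j = 0 := by
  induction k generalizing j with
  | zero => exact absurd (one_dvd j) hj
  | succ k ih =>
    exact coeffs_mulPullback_step π c hp (natCast_eq_zero_of_coeffs_eq_zero π c hp hh hc) k
      (ih (by omega)) (hc _ (Nat.pow_lt_pow_right hp.one_lt (by omega))) j hj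

/-- Over a local ring, the leading coefficient of multiplication by `p` on a formal Lie group of
exact height is invertible. -/
lemma HasHeight.isUnit_coeffs {O : Type u} [CommRing O] [IsLocalRing O]
    (π : S ⟶ Spec (CommRingCat.of O)) [IsIso π] {p h : ℕ} (hp : p.Prime) (hh : 1 ≤ h)
    (hX : HasHeight p h S X) : IsUnit (c.coeffs π (mulPullback p X c.fn) (p ^ h)) := by
  -- A non-unit leading coefficient dies in the residue field, where multiplication by `p` becomes a
  -- series in `T ^ (p ^ (h + 1))`, contradicting exact height there.
  by_contra hu
  set g := IsLocalRing.residue O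
  set f := Spec.map (CommRingCat.ofHom g) ≫ inv π
  set π' := 𝟙 (Spec (CommRingCat.of (IsLocalRing.ResidueField O)))
  have hf : f ≫ π = π' ≫ Spec.map (CommRingCat.ofHom g) := by simp [f, π']
  have hcoe := fun i => c.coeffs_restrictFn π π' f g hf (mulPullback p X c.fn) i
  have hres : ∀ i < p ^ h, (c.restrict f).coeffs π' (mulPullback p _ (c.restrict f).fn) i = 0 :=
    fun i hi => (hcoe i).trans (by rw [hX.1.coeffs_eq_zero π c hi, map_zero])
  have hlead : (c.restrict f).coeffs π' (mulPullback p _ (c.restrict f).fn) (p ^ h) = 0 :=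
    (hcoe _).trans (by
      rw [IsLocalRing.residue_eq_zero_iff]
      exact hu)
  have : Nonempty (Spec (CommRingCat.of (IsLocalRing.ResidueField O))) :=
    inferInstanceAs (Nonempty (PrimeSpectrum (IsLocalRing.ResidueField O)))
  refine hX.2 _ f (heightGE_of_coeffs_eq_zero π' (c.restrict f) fun i hi => ?_)
  -- Divisibility does not exclude index `0`, which vanishes because the zero section is preserved.
  rcases Nat.eq_zero_or_pos i with rfl | hi0
  · exact (c.restrict f).coeffs_zero π' (mulPullback_mem (c.restrict f).fn_mem)
  · exact coeffs_mulPullback_step π' _ hp (natCast_eq_zero_of_coeffs_eq_zero π' _ hp hh hres) h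
      (coeffs_mulPullback_of_not_dvd π' _ hp hh hres le_rfl) hlead i
      fun hd => absurd (Nat.le_of_dvd hi0 hd) (not_le.2 hi)

end Height

/-- Formal Lie groups over local rings have a global coordinate. -/
lemma IsFormalLieGroup.exists_coordinate {O : Type u} [CommRing O] [IsLocalRing O]
    {X : GroupSheaf (Spec (CommRingCat.of O))} (hX : IsFormalLieGroup _ X) :
    Nonempty (Coordinate X) := by
  obtain ⟨U, hU, ⟨c⟩⟩ := hX (IsLocalRing.closedPoint O)
  -- The closed point has no open neighbourhood other than the whole spectrum.
  obtain rfl : U = (⊤ : (Spec (CommRingCat.of O)).Opens) :=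
    (IsLocalRing.closedPoint_mem_iff U).1 hU
  have : IsIso (⊤ : (Spec (CommRingCat.of O)).Opens).ι :=
    inferInstanceAs (IsIso (Scheme.topIso (Spec (CommRingCat.of O))).hom)
  have c' := (c.restrict (inv (Scheme.Opens.ι (⊤ : (Spec (CommRingCat.of O)).Opens)))).ofIso (restrictCompIso _ _ X)
  rw [IsIso.inv_hom_id] at c'
  exact ⟨c'.ofIso ((Scheme.fppfTopology.overMapPullbackId AddCommGrpCat.{u} _).app X)⟩

/-! ### Homomorphisms as power series. -/

section Homs

variable {S : Scheme.{u}} {X Y : GroupSheaf S}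

lemma Coordinate.hom_ext (cY : Coordinate Y) {e e' : X ⟶ Y}
    (h : functionsMap e cY.fn = functionsMap e' cY.fn) : e = e' := by
  refine Sheaf.hom_ext (NatTrans.ext (funext fun Z => ?_))
  refine AddCommGrpCat.hom_ext (AddMonoidHom.ext fun x => ?_)
  exact cY.ext_of_fn_eq (Z := Z.unop) (congrFun (congrFun (congrArg Subtype.val h) Z.unop) x)

variable {A : Type u} [CommRing A] (π : S ⟶ Spec (CommRingCat.of A)) [IsIso π]

/-- A series without constant term takes nilpotent values at nilpotents, so it can serve as the
coordinate of a point of another group. -/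
lemma Coordinate.isLocallyNilpotent_apply (c : Coordinate X) {φ : functions X}
    (hφ : c.coeffs π φ 0 = 0) (Z : Over S) (x : X.obj.obj (op Z)) :
    IsLocallyNilpotent Z.left (φ.1 Z x) := by
  intro z
  obtain ⟨U, hz, hU⟩ := c.exists_isNilpotent x z
  refine ⟨U, hz, ?_⟩
  obtain ⟨n, hn⟩ := hU U le_rfl
  have h1 : IsNilpotent (φ.1 _ (X.obj.map (openOverι Z U).op x)) := by
    rw [c.apply_eq π φ _ _ hn]
    refine isNilpotent_sum fun i _ => ?_
    rcases Nat.eq_zero_or_pos i with rfl | hi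
    · rw [hφ, map_zero, zero_mul]
      exact IsNilpotent.zero
    · exact (Commute.all _ _).isNilpotent_mul_left (IsNilpotent.pow_of_pos ⟨n, hn⟩ hi.ne')
  rw [φ.2] at h1
  change IsNilpotent (U.ι.appTop (φ.1 Z x)) at h1
  rw [Scheme.Opens.ι_appTop] at h1
  have h2 : (φ.1 Z x) |_ U = Z.left.presheaf.map (homOfLE U.ι_image_top.ge).op
      (Z.left.presheaf.map (homOfLE (le_top : U.ι ''ᵁ ⊤ ≤ ⊤)).op (φ.1 Z x)) :=
    ConcreteCategory.congr_hom (Z.left.presheaf.map_comp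
      (homOfLE (le_top : U.ι ''ᵁ ⊤ ≤ ⊤)).op (homOfLE U.ι_image_top.ge).op) (φ.1 Z x)
  rw [h2]
  exact h1.map (Z.left.presheaf.map _).hom

/-- Homomorphisms commute with multiplication by `p`, in terms of coefficients. -/
lemma coeffs_comp (cX : Coordinate X) (cY : Coordinate Y) (e : X ⟶ Y) (m N i : ℕ) (hi : i < N) :
    (∑ j ∈ Finset.range N, Polynomial.C (cX.coeffs π (functionsMap e cY.fn) j) *
      (∑ l ∈ Finset.range N, Polynomial.C (cX.coeffs π (mulPullback m X cX.fn) l) *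
        Polynomial.X ^ l) ^ j : Polynomial A).coeff i =
    (∑ j ∈ Finset.range N, Polynomial.C (cY.coeffs π (mulPullback m Y cY.fn) j) *
      (∑ l ∈ Finset.range N, Polynomial.C (cX.coeffs π (functionsMap e cY.fn) l) *
        Polynomial.X ^ l) ^ j : Polynomial A).coeff i := by
  refine Trunc.coeff_eq_of_eval₂_eq (n := N) ?_ hi
  simp only [Polynomial.eval₂_finsetSum, Polynomial.eval₂_mul, Polynomial.eval₂_pow,
    Polynomial.eval₂_C, Polynomial.eval₂_X]
  -- Such values are divisible by `t`, so expansions in them may be cut off at `N`.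
  have hpow : ∀ φ ∈ augmentationIdeal X, ev π _ (cX.pt π (Trunc.C N A) (Trunc.t N A)
      (Trunc.isNilpotent_t _)) φ ^ N = 0 := by
    intro φ hφ
    have hd : Trunc.t N A ∣ ev π _ (cX.pt π (Trunc.C N A) (Trunc.t N A)
        (Trunc.isNilpotent_t _)) φ := by
      rw [cX.ev_univ π]
      refine Finset.dvd_sum fun j _ => ?_
      rcases Nat.eq_zero_or_pos j with rfl | hj
      · rw [cX.coeffs_zero π hφ, map_zero, zero_mul]
        exact dvd_zero _
      · exact Dvd.dvd.mul_left (dvd_pow_self _ hj.ne') _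
    have h := pow_dvd_pow_of_dvd hd N
    rwa [Trunc.t_pow, zero_dvd_iff] at h
  simp only [← cX.ev_univ π]
  set x := cX.pt π (Trunc.C N A) (Trunc.t N A) (Trunc.isNilpotent_t _)
  have h1 := cX.ev_eq π (functionsMap e cY.fn) _ (m • x) (hpow _ (mulPullback_mem cX.fn_mem))
  have h2 := cY.ev_eq π (mulPullback m Y cY.fn) _ (e.hom.app (op (affPt π (Trunc.C N A))) x)
    (hpow _ (functionsMap_mem e cY.fn cY.fn_mem))
  refine h1.symm.trans (Eq.trans ?_ h2)
  change (affΓ π _).symm (cY.fn.1 _ (e.hom.app _ (m • x))) =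
    (affΓ π _).symm (cY.fn.1 _ (m • e.hom.app _ x))
  rw [map_nsmul]

end Homs

/-! ### Descent of homomorphisms along an injection of rings. -/

section Descent

variable {S S' : Scheme.{u}} {X Y : GroupSheaf S} {A A' : Type u} [CommRing A] [CommRing A']
  (π : S ⟶ Spec (CommRingCat.of A)) (π' : S' ⟶ Spec (CommRingCat.of A')) [IsIso π] [IsIso π']
  (f : S' ⟶ S) (g : A →+* A') (hf : f ≫ π = π' ≫ Spec.map (CommRingCat.ofHom g))
  (hg : Function.Injective g)

include hf hg in
/-- Base change along an injective homomorphism of rings is faithful. -/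
lemma restrict_map_injective (cX : Coordinate X) (cY : Coordinate Y) {e e' : X ⟶ Y}
    (h : (restrict f).map e = (restrict f).map e') : e = e' := by
  refine cY.hom_ext (cX.functions_ext_coeffs π (funext fun i => hg ?_))
  rw [← cX.coeffs_restrictFn π π' f g hf, ← cX.coeffs_restrictFn π π' f g hf]
  change (cX.restrict f).coeffs π' (functionsMap ((restrict f).map e) (cY.restrict f).fn) i =
    (cX.restrict f).coeffs π' (functionsMap ((restrict f).map e') (cY.restrict f).fn) i
  rw [h]

include hf hg in
/-- A homomorphism descends along an injective homomorphism of rings as soon as its coefficients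
do. -/
lemma exists_hom_of_coeffs_mem_range (cX : Coordinate X) (cY : Coordinate Y)
    (e : (restrict f).obj X ⟶ (restrict f).obj Y)
    (he : ∀ i, (cX.restrict f).coeffs π' (functionsMap e (cY.restrict f).fn) i ∈ Set.range g) :
    ∃ e' : X ⟶ Y, (restrict f).map e' = e := by
  choose a ha using he
  obtain ⟨φ, hφ⟩ := cX.exists_function π a
  have hres : restrictFn f φ = functionsMap e (cY.restrict f).fn := by
    refine (cX.restrict f).functions_ext_coeffs π' (funext fun i => ?_)
    rw [cX.coeffs_restrictFn π π' f g hf, hφ, ha]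
  have h0 : cX.coeffs π φ 0 = 0 := by
    apply hg
    rw [hφ, ha, map_zero]
    exact (cX.restrict f).coeffs_zero π' (functionsMap_mem e _ (cY.restrict f).fn_mem)
  let m : ∀ Z : Over S, X.obj.obj (op Z) → Y.obj.obj (op Z) := fun Z x =>
    (cY.equiv Z).symm ⟨φ.1 Z x, cX.isLocallyNilpotent_apply π h0 Z x⟩
  have hm : ∀ Z x, cY.fn.1 Z (m Z x) = φ.1 Z x := fun Z x =>
    congrArg Subtype.val ((cY.equiv Z).apply_symm_apply _)
  have mnat : ∀ {Z Z' : Over S} (k : Z' ⟶ Z) (x : X.obj.obj (op Z)),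
      m Z' (X.obj.map k.op x) = Y.obj.map k.op (m Z x) := by
    intro Z Z' k x
    apply cY.ext_of_fn_eq
    rw [hm, cY.fn.2, hm, φ.2]
  have hme : ∀ (W : Over S') (x : X.obj.obj (op ((Over.map f).obj W))),
      m ((Over.map f).obj W) x = e.hom.app (op W) x := by
    intro W x
    refine cY.ext_of_fn_eq (Z := (Over.map f).obj W) ((hm _ x).trans ?_)
    exact congrFun (congrFun (congrArg Subtype.val hres) W) x
  have madd : ∀ Z (x y : X.obj.obj (op Z)), m Z (x + y) = m Z x + m Z y := by
    intro Z x y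
    apply cY.ext_of_fn_eq
    refine functions_apply_eq_of_locally fun z => ?_
    obtain ⟨U₁, hz₁, hU₁⟩ := cX.exists_isNilpotent x z
    obtain ⟨U₂, hz₂, hU₂⟩ := cX.exists_isNilpotent y z
    refine ⟨U₁ ⊓ U₂, ⟨hz₁, hz₂⟩, ?_⟩
    obtain ⟨n₁, hn₁⟩ := hU₁ (U₁ ⊓ U₂) inf_le_left
    obtain ⟨n₂, hn₂⟩ := hU₂ (U₁ ⊓ U₂) inf_le_right
    rw [← mnat, map_add, map_add, ← mnat, ← mnat]
    generalize X.obj.map (openOverι Z (U₁ ⊓ U₂)).op x = x' at hn₁ ⊢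
    generalize X.obj.map (openOverι Z (U₁ ⊓ U₂)).op y = y' at hn₂ ⊢
    generalize openOver Z (U₁ ⊓ U₂) = V at x' y' hn₁ hn₂ ⊢
    set r := (Trunc.C n₂ (Trunc n₁ A)).comp (Trunc.C n₁ A)
    set x₀ := cX.pt π r (Trunc.C n₂ _ (Trunc.t n₁ A)) (Trunc.isNilpotent_C_t n₁ n₂)
    set y₀ := cX.pt π r (Trunc.t n₂ _) (Trunc.isNilpotent_t n₂)
    -- Additivity is checked on the universal pair: its coefficient ring over `A` embeds in the one
    -- over `A'`, where `m` coincides with the homomorphism `e`.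
    have huniv : cY.fn.1 _ (m _ (x₀ + y₀)) = cY.fn.1 _ (m _ x₀ + m _ y₀) := by
      set r' := (Trunc.C n₂ (Trunc n₁ A')).comp (Trunc.C n₁ A')
      set W := affPt π' r'
      set G : Trunc n₂ (Trunc n₁ A) →+* Γ(((Over.map f).obj W).left, ⊤) :=
        (affΓ π' r' : _ →+* Γ(W.left, ⊤)).comp (Trunc.map n₂ (Trunc.map n₁ g)) with hGdef
      have hG : G.comp r = structMap π ((Over.map f).obj W) := by
        ext b
        rw [structMap_map π π' f g hf, structMap_affPt]
        simp only [hGdef, r, r', RingHom.comp_apply, Trunc.map_C]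
        rfl
      have hGinj : Function.Injective G :=
        (affΓ π' r').injective.comp (Trunc.map_injective n₂ (Trunc.map_injective n₁ hg))
      rw [← affΓ_ev, ← affΓ_ev]
      congr 1
      apply hGinj
      rw [← toAffPt_appTop π r G hG, ← toAffPt_appTop π r G hG, affΓ_ev, affΓ_ev,
        ← cY.fn.2, ← cY.fn.2, ← mnat, map_add, map_add, ← mnat, ← mnat, hme, hme, hme]
      exact congrArg (cY.fn.1 ((Over.map f).obj W)) (map_add (e.hom.app (op W)).hom _ _)
    -- The local pair is a specialization of the universal one.
    set F := Trunc.lift (Trunc.lift (structMap π V) _ hn₁) _ hn₂ with hF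
    have hFr : F.comp r = structMap π V := by
      ext b
      simp [F, r]
    have hx' : x' = X.obj.map (toAffPt π r F hFr).op x₀ := by
      apply cX.ext_of_fn_eq
      rw [cX.fn.2, ← affΓ_ev, cX.ev_pt π, toAffPt_appTop, hF, Trunc.lift_C, Trunc.lift_t]
    have hy' : y' = X.obj.map (toAffPt π r F hFr).op y₀ := by
      apply cX.ext_of_fn_eq
      rw [cX.fn.2, ← affΓ_ev, cX.ev_pt π, toAffPt_appTop, hF, Trunc.lift_t]
    rw [hx', hy', ← map_add, mnat, mnat, mnat, ← map_add, cY.fn.2, cY.fn.2, huniv]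
  refine ⟨⟨{ app := fun Z => AddCommGrpCat.ofHom (AddMonoidHom.mk' (m Z.unop) (madd Z.unop))
             naturality := fun Z Z' k => ?_ }⟩, ?_⟩
  · refine AddCommGrpCat.hom_ext (AddMonoidHom.ext fun x => ?_)
    exact mnat k.unop x
  · refine Sheaf.hom_ext (NatTrans.ext (funext fun W => ?_))
    refine AddCommGrpCat.hom_ext (AddMonoidHom.ext fun x => ?_)
    exact hme W.unop x

end Descent

/-! ### Extension over a valuation ring. -/

/-- Homomorphisms of formal Lie groups of height `h` extend from the field of fractions of a
valuation ring to the valuation ring. -/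
lemma exists_hom_of_valuationRing {p h : ℕ} [Fact p.Prime] (hh : 1 ≤ h)
    {O K : Type u} [CommRing O] [IsDomain O] [ValuationRing O] [Field K] [Algebra O K]
    [IsFractionRing O K] {X Y : GroupSheaf (Spec (CommRingCat.of O))} (cX : Coordinate X)
    (cY : Coordinate Y) (hX : HasHeight p h _ X) (hY : HasHeight p h _ Y)
    (e : (restrict (Spec.map (CommRingCat.ofHom (algebraMap O K)))).obj X ⟶
      (restrict (Spec.map (CommRingCat.ofHom (algebraMap O K)))).obj Y) :
    ∃ e' : X ⟶ Y, (restrict (Spec.map (CommRingCat.ofHom (algebraMap O K)))).map e' = e := by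
  have hp : p.Prime := Fact.out
  let f := Spec.map (CommRingCat.ofHom (algebraMap O K))
  set π := 𝟙 (Spec (CommRingCat.of O))
  set π' := 𝟙 (Spec (CommRingCat.of K))
  have hf : f ≫ π = π' ≫ Spec.map (CommRingCat.ofHom (algebraMap O K)) := by simp [f, π, π']
  have hcX := fun i (hi : i < p ^ h) => hX.1.coeffs_eq_zero π cX hi
  have hcY := fun i (hi : i < p ^ h) => hY.1.coeffs_eq_zero π cY hi
  have hpO : (p : O) = 0 := natCast_eq_zero_of_coeffs_eq_zero π cX hp hh hcX
  have hpK : (p : K) = 0 := by rw [← map_natCast (algebraMap O K), hpO, map_zero]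
  have : CharP K p := (CharP.charP_iff_prime_eq_zero hp).2 hpK
  refine exists_hom_of_coeffs_mem_range π π' f (algebraMap O K) hf (IsFractionRing.injective O K)
    cX cY e fun i => ?_
  -- The valuation ring enters here as an integrally closed local domain; exactness of the height
  -- enters through the unit leading coefficient for `Y`.
  refine coeff_mem_range_of_comp_eq (p := p) hh (f := (cX.restrict f).coeffs π' _)
    (a := cX.coeffs π (mulPullback p X cX.fn)) (b := cY.coeffs π (mulPullback p Y cY.fn))
    ((cX.restrict f).coeffs_zero π' (functionsMap_mem e _ (cY.restrict f).fn_mem)) hcX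
    (fun j hj => coeffs_mulPullback_of_not_dvd π cY hp hh hcY le_rfl j hj)
    (cY.coeffs_zero π (mulPullback_mem cY.fn_mem)) (hY.isUnit_coeffs cY π hp hh) ?_ i
  intro N j hj
  have key := coeffs_comp π' (cX.restrict f) (cY.restrict f) e p N j hj
  simp only [← restrictFn_mulPullback, Coordinate.coeffs_restrictFn π π' f _ hf] at key
  exact key

end FormalLie

end

theorem mainTheorem11 (p : ℕ) [Fact p.Prime] (h : ℕ) (hh : 1 ≤ h)
    (O : Type u) [CommRing O] [IsDomain O] [ValuationRing O]
    (K : Type u) [Field K] [Algebra O K] [IsFractionRing O K] :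
    (FormalLie.FLG.baseChange p h (Spec.map (CommRingCat.ofHom (algebraMap O K)))).Full ∧
      (FormalLie.FLG.baseChange p h (Spec.map (CommRingCat.ofHom (algebraMap O K)))).Faithful := by
  set f := Spec.map (CommRingCat.ofHom (algebraMap O K))
  -- Stated for all homomorphisms, not only isomorphisms, so that it also identifies composites with
  -- identities.
  have inj : ∀ {X Y : FormalLie.FLG p h (Spec (CommRingCat.of O))} {e e' : X.of.obj ⟶ Y.of.obj},
      (FormalLie.restrict f).map e = (FormalLie.restrict f).map e' → e = e' := by
    intro X Y e e' he
    obtain ⟨cX⟩ := X.of.property.1.exists_coordinate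
    obtain ⟨cY⟩ := Y.of.property.1.exists_coordinate
    exact FormalLie.restrict_map_injective (𝟙 _) (𝟙 _) f (algebraMap O K) (by simp [f])
      (IsFractionRing.injective O K) cX cY he
  have surj : ∀ {X Y : FormalLie.FLG p h (Spec (CommRingCat.of O))}
      (e : (FormalLie.restrict f).obj X.of.obj ⟶ (FormalLie.restrict f).obj Y.of.obj),
      ∃ e' : X.of.obj ⟶ Y.of.obj, (FormalLie.restrict f).map e' = e := by
    intro X Y e
    obtain ⟨cX⟩ := X.of.property.1.exists_coordinate
    obtain ⟨cY⟩ := Y.of.property.1.exists_coordinate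
    exact FormalLie.exists_hom_of_valuationRing hh cX cY X.of.property.2 Y.of.property.2 e
  refine ⟨⟨fun {X Y} e => ?_⟩, ⟨fun {X Y} e e' he => ?_⟩⟩
  -- The isomorphism and its inverse are extended separately; faithfulness makes the extensions
  -- mutually inverse.
  · obtain ⟨u, hu⟩ := surj e.iso.hom.hom
    obtain ⟨v, hv⟩ := surj e.iso.inv.hom
    have huv : u ≫ v = 𝟙 _ := inj (X := X) (Y := X) (by
      refine (Functor.map_comp _ _ _).trans (Eq.trans ?_ (CategoryTheory.Functor.map_id _ _).symm)
      rw [hu, hv]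
      exact congrArg (fun k => k.hom) e.iso.hom_inv_id)
    have hvu : v ≫ u = 𝟙 _ := inj (X := Y) (Y := Y) (by
      refine (Functor.map_comp _ _ _).trans (Eq.trans ?_ (CategoryTheory.Functor.map_id _ _).symm)
      rw [hu, hv]
      exact congrArg (fun k => k.hom) e.iso.inv_hom_id)
    refine ⟨⟨⟨ObjectProperty.homMk u, ObjectProperty.homMk v, ?_, ?_⟩⟩, ?_⟩
    · exact ObjectProperty.hom_ext _ huv
    · exact ObjectProperty.hom_ext _ hvu
    · exact Core.hom_ext (ObjectProperty.hom_ext _ hu)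
  · refine Core.hom_ext (ObjectProperty.hom_ext _ (inj ?_))
    exact congrArg (fun k => k.iso.hom.hom) he
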